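/- Let $(W,S)$ be an arbitrary Coxeter system with $S$ finite ($W$ possibly infinite), with Coxeter diagram $\Gamma$ (a graph on $S$, with $s\ne s'$ joined when $m(s,s')\ge 3$ or $m(s,s')=\infty$). Let $\Phi=\{w\alpha_s\}$ be its root system in the geometric representation $V=\mathbb{R}^S$ with basis the simple roots $\alpha_s$, let $\Phi^+$ be the set of positive roots, and let $M_\Phi$ be the (oriented) matroid of the vector configuration $\Phi^+$. For a flat $F$ of $M_\Phi$ let $X_F=\{f\in V^*: f|_F=0\}$, and let $T=\bigcup_{w\in W} w(R)\subset V^*$ be the Tits cone, where $R=\{f: f(\alpha_s)\ge 0 \text{ for all } s\}$. A flat $F$ is *parabolic* if $\dim(X_F\cap T)=\dim X_F$ (every flat is, if $W$ is finite), and *positive* if it is a parabolic flat of the form $\{\alpha\in\Phi^+: f(\alpha)=0\}$ for some $f\in V^*$ that is nonnegative on $\Phi^+$. To a flag $\mathcal F$: $\emptyset=F_0\subset F_1\subset\dots\subset F_k\subset F_{k+1}=\Phi^+$ of positive flats (all inclusions strict) associate the matroid $M_{\mathcal F}=\bigoplus_{i=1}^{k+1}F_i/F_{i-1}$. The *positive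 Bergman complex* $\mathcal B^+(M_\Phi)$ is the order complex of the poset of positive flats other than $\emptyset$ and $\Phi^+$; its simplices (the empty one included) are the flags of positive flats. The cells of its *coarse subdivision* are the classes of flags with the same matroid $M_{\mathcal F}$; a cell $c$ is a face of a cell $d$ if $c$ lies in the closure of $d$, that is, if every flag in $c$ is contained in a flag in $d$. For a connected graph $G$ on $n$ nodes, a *tube* is a proper nonempty set of nodes inducing a connected subgraph; a *tubing* is a set of tubes any two distinct members of which are either nested, or disjoint with a union that does not induce a connected subgraph. The *graph associahedron* $P(G)$ is a polytope obtained from an $(n-1)$-simplex, whose facets correspond to the nodes, by successively truncating, for all tubes $t$ in increasing order of dimension of the corresponding faces, the face that is the intersection of the facets of the nodes in $t$. For a graph $\Gamma$ with connected components $\Gamma_1,\dots,\Gamma_c$, put $P(\Gamma)=P(\Gamma_1)\times\dots\times P(\Gamma_c)$, and let a tubing of $\Gamma$ be a tuple of tubings of $\Gamma_1,\dots,\Gamma_c$, ordered by componentwise containment. **Theorem.** The polytope $P(\Gamma)$ exists, and, for every choice made in its construction, the face poset of the coarse subdivision of $\mathcal B^+(M_\Phi)$ (with the cell of the empty flag)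 is dual, i.e. anti-isomorphic, to the poset of nonempty faces of $P(\Gamma)$. Moreover it is isomorphic to the poset of tubings of $\Gamma$ ordered by containment. -/

import Mathlib

/-! ### The matroid of a vector configuration, and the matroid of a flag -/

namespace Bergman

open Set

/-- The matroid represented by a set `E` of vectors: ground set `E`, and a subset of `E` is
independent iff it is linearly independent. -/
noncomputable def linearMatroid {V : Type*} [AddCommGroup V] [Module ℝ V] (E : Set V) :
    Matroid V :=
  (IndepMatroid.ofFinitary E (fun I => I ⊆ E ∧ LinearIndepOn ℝ id I)
    ⟨empty_subset _, linearIndepOn_empty ℝ id⟩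
    (fun _ _ hJ hIJ => ⟨hIJ.trans hJ.1, hJ.2.mono hIJ⟩)
    (by
      intro I B hI hImax hB
      by_contra! hcon
      have hBI : B ⊆ Submodule.span ℝ I := by
        intro x hx
        by_contra hxI
        exact hcon x ⟨hx, fun h => hxI (Submodule.subset_span h)⟩
          (insert_subset (hB.prop.1 hx) hI.1) (hI.2.id_insert hxI)
      apply hImax
      refine ⟨hI, fun J hJ hIJ x hx => ?_⟩
      by_contra hxI
      have hxB : x ∈ Submodule.span ℝ B := by
        by_contra hxB
        have h := hB.le_of_ge (y := insert x B)
          ⟨insert_subset (hJ.1 hx) hB.prop.1, hB.prop.2.id_insert hxB⟩ (subset_insert x B)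
        exact hxB (Submodule.subset_span (h (mem_insert x B)))
      have hxs : x ∈ Submodule.span ℝ I := Submodule.span_le.2 hBI hxB
      have h2 : LinearIndepOn ℝ id (insert x I) := hJ.2.mono (insert_subset hx hIJ)
      exact ((linearIndepOn_id_insert hxI).1 h2).2 hxs)
    (by
      intro I h
      refine ⟨fun x hx => (h {x} (by simpa using hx) (finite_singleton x)).1 rfl, ?_⟩
      exact linearIndepOn_of_finite I fun t ht hfin => (h t ht hfin).2)
    (fun _ hI => hI.1)).matroid

/-- For a member `F` of a chain `𝓕` of flats (or `F` the ground set), the union of the members of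
`𝓕` strictly below `F`: the member of `𝓕` immediately preceding `F`, or `∅` if there is none. -/
def pred {α : Type*} (𝓕 : Set (Set α)) (F : Set α) : Set α := ⋃₀ {G ∈ 𝓕 | G ⊂ F}

/-- The matroid `M_𝓕 = ⨁ᵢ Fᵢ / Fᵢ₋₁` of a flag `∅ = F₀ ⊂ F₁ ⊂ ⋯ ⊂ F_k ⊂ F_{k+1} = E` of subsets of
the ground set `E`, given by the chain `𝓕 = {F₁, …, F_k}`. The summands are indexed by
`F ∈ 𝓕 ∪ {E}`; the summand of `F` is the contraction of the preceding member of the flag in the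
restriction of `M` to `F`. -/
noncomputable def flagMatroid {α : Type*} (M : Matroid α) (𝓕 : Set (Set α))
    (hsub : ∀ F ∈ 𝓕, F ⊆ M.E) (hchain : IsChain (· ⊆ ·) 𝓕) : Matroid α :=
  Matroid.disjointSigma
    (fun F : (insert M.E 𝓕 : Set (Set α)) => (M.restrict F.1).contract (pred 𝓕 F.1))
    (by
      have key : ∀ F G : (insert M.E 𝓕 : Set (Set α)), F ≠ G → F.1 ⊆ G.1 →
          F.1 ⊆ pred 𝓕 G.1 := by
        rintro ⟨F, hF⟩ ⟨G, hG⟩ hne hFG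
        have hss : F ⊂ G := LE.le.ssubset_of_ne hFG fun h => hne (Subtype.ext h)
        rcases hF with rfl | hF
        · rcases hG with rfl | hG
          · exact absurd rfl hne
          · exact absurd (hsub G hG) hss.2
        · exact subset_sUnion_of_mem ⟨hF, hss⟩
      intro F G hne
      have htot : F.1 ⊆ G.1 ∨ G.1 ⊆ F.1 := by
        have hc : IsChain (· ⊆ ·) (insert M.E 𝓕) :=
          hchain.insert fun b hb _ => Or.inr (hsub b hb)
        exact hc.total F.2 G.2
      rw [Function.onFun, Set.disjoint_left]
      intro x hxF hxG
      rcases htot with h | h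
      · exact hxG.2 (key F G hne h hxF.1)
      · exact hxF.2 (key G F hne.symm h hxG.1))

end Bergman

/-! ### The geometric representation, roots, and the Tits cone -/

namespace CoxeterMatrix

variable {B : Type*} [Fintype B] [DecidableEq B] (M : CoxeterMatrix B)

/-- The Coxeter diagram (as an unlabelled graph): `i` and `j` are joined iff `m(i, j) ≥ 3` or
`m(i, j) = ∞`, the latter being encoded by the matrix entry `0`. -/
def diagram {B : Type*} (M : CoxeterMatrix B) : SimpleGraph B where
  Adj i j := i ≠ j ∧ (M i j = 0 ∨ 3 ≤ M i j)
  symm := ⟨fun i j h => ⟨h.1.symm, by rw [M.symmetric j i]; exact h.2⟩⟩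
  loopless := ⟨fun _ h => h.1 rfl⟩

/-- The simple root `α_i`, in the space `V = B → ℝ` with basis the simple roots. -/
def simpleRoot (i : B) : B → ℝ := Pi.single i 1

/-- The bilinear form with `(α_i, α_j) = -cos (π / m(i, j))`. For `m(i, j) = ∞`, encoded by `0`, the
convention `π / 0 = 0` gives the right value `-1`. -/
noncomputable def form : LinearMap.BilinForm ℝ (B → ℝ) :=
  Matrix.toBilin' (Matrix.of fun i j => -Real.cos (Real.pi / M i j))

lemma form_simpleRoot (i j : B) :
    M.form (simpleRoot i) (simpleRoot j) = -Real.cos (Real.pi / M i j) := by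
  simp [form, simpleRoot]

lemma two_smul_form_self (i : B) : (2 • M.form.flip (simpleRoot i)) (simpleRoot i) = (2 : ℝ) := by
  simp [form_simpleRoot]

/-- The reflection `v ↦ v - 2 (v, α_i) α_i`. -/
noncomputable def simpleReflection (i : B) : (B → ℝ) ≃ₗ[ℝ] (B → ℝ) :=
  Module.reflection (M.two_smul_form_self i)

lemma simpleReflection_apply (i : B) (v : B → ℝ) :
    M.simpleReflection i v = v - (2 * M.form v (simpleRoot i)) • simpleRoot i := by
  simp [simpleReflection, Module.reflection_apply]

/-- The simple reflections satisfy the Coxeter relations. -/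
lemma isLiftable_simpleReflection : M.IsLiftable M.simpleReflection := by
  intro i j
  by_cases hij : i = j
  · subst hij
    rw [M.diagonal, pow_one]
    ext1 v
    exact Module.involutive_reflection (M.two_smul_form_self i) v
  have hone : M i j ≠ 1 := M.off_diagonal i j hij
  generalize hm : M i j = m at hone
  rcases Nat.eq_zero_or_pos m with rfl | hpos
  · exact pow_zero _
  have hfy : (2 • M.form.flip (simpleRoot i)) (simpleRoot j) = -2 * Real.cos (Real.pi / m) := by
    simp [form_simpleRoot, M.symmetric j i, hm]
  have hgx : (2 • M.form.flip (simpleRoot j)) (simpleRoot i) = -2 * Real.cos (Real.pi / m) := by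
    simp [form_simpleRoot, hm]
  have hm0 : (m : ℝ) ≠ 0 := by positivity
  set θ : ℝ := 2 * (Real.pi / m) with hθ
  have ht : 2 * Real.cos θ = (2 • M.form.flip (simpleRoot i)) (simpleRoot j) *
      (2 • M.form.flip (simpleRoot j)) (simpleRoot i) - 2 := by
    rw [hfy, hgx, hθ, Real.cos_two_mul]; ring
  ext1 v
  rw [simpleReflection, simpleReflection,
    Module.reflection_mul_reflection_pow_apply _ _ m v (2 * Real.cos θ) ht]
  by_cases h2 : m = 2
  · subst h2
    have hc : Real.cos θ = -1 := by
      rw [hθ]; push_cast; rw [mul_div_cancel₀ _ (two_ne_zero)]; exact Real.cos_pi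
    have hz : Real.cos (Real.pi / (2 : ℕ)) = 0 := by push_cast; exact Real.cos_pi_div_two
    rw [hfy, hgx, hz, hc]
    norm_num
    module
  have hθ0 : 0 < θ := by positivity
  have hθπ : θ < Real.pi := by
    have h3 : (3 : ℝ) ≤ m := by exact_mod_cast (by omega : 3 ≤ m)
    rw [hθ, ← mul_div_assoc, div_lt_iff₀ (by positivity)]
    nlinarith [Real.pi_pos]
  have hs : Real.sin θ ≠ 0 := (Real.sin_pos_of_pos_of_lt_pi hθ0 hθπ).ne'
  have hS : ∀ n : ℤ, (Polynomial.Chebyshev.S ℝ n).eval (2 * Real.cos θ) =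
      Real.sin ((n + 1) * θ) / Real.sin θ := fun n => by
    rw [eq_div_iff hs]; exact Polynomial.Chebyshev.S_two_mul_real_cos θ n
  rcases Nat.even_or_odd' m with ⟨k, rfl | rfl⟩
  · have e1 : ((2 * k : ℕ) - 2 : ℤ) / 2 = k - 1 := by omega
    have e2 : ((2 * k : ℕ) - 1 : ℤ) / 2 = k - 1 := by omega
    have h0 : (Polynomial.Chebyshev.S ℝ ((k : ℤ) - 1)).eval (2 * Real.cos θ) = 0 := by
      rw [hS]
      have : (((k : ℤ) - 1 : ℤ) + 1 : ℝ) * θ = Real.pi := by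
        have hk : (k : ℝ) ≠ 0 := by
          rintro h
          simp [h] at hm0
        rw [hθ]; push_cast; field_simp; ring
      rw [this, Real.sin_pi, zero_div]
    rw [e1, e2, h0]
    simp
  · have e1 : ((2 * k + 1 : ℕ) - 1 : ℤ) / 2 = k := by omega
    have e2 : ((2 * k + 1 : ℕ) - 3 : ℤ) / 2 = k - 1 := by omega
    have e3 : ((2 * k + 1 : ℕ) : ℤ) / 2 = k := by omega
    have e4 : ((2 * k + 1 : ℕ) - 2 : ℤ) / 2 = k - 1 := by omega
    have h0 : (Polynomial.Chebyshev.S ℝ (k : ℤ)).eval (2 * Real.cos θ) +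
        (Polynomial.Chebyshev.S ℝ ((k : ℤ) - 1)).eval (2 * Real.cos θ) = 0 := by
      rw [hS, hS, ← add_div]
      have : ((k : ℤ) + 1 : ℝ) * θ = 2 * Real.pi - (((k : ℤ) - 1 : ℤ) + 1 : ℝ) * θ := by
        push_cast at hm0 ⊢
        rw [hθ]; push_cast; field_simp; ring
      rw [this, Real.sin_two_pi_sub, neg_add_cancel, zero_div]
    rw [e1, e2, e3, e4, h0]
    simp

end CoxeterMatrix

namespace CoxeterSystem

open Set CoxeterMatrix

variable {B : Type*} [Fintype B] [DecidableEq B] {M : CoxeterMatrix B} {W : Type*} [Group W]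
  (cs : CoxeterSystem M W)

/-- The geometric representation of `W` on `V = B → ℝ`, in which the simple generator `s_i` acts by
the reflection `v ↦ v - 2 (v, α_i) α_i`. -/
noncomputable def geomRep : W →* ((B → ℝ) ≃ₗ[ℝ] (B → ℝ)) :=
  cs.lift ⟨M.simpleReflection, M.isLiftable_simpleReflection⟩

/-- The root system `Φ = {w α_i}`. -/
def roots : Set (B → ℝ) := {v | ∃ (w : W) (i : B), v = cs.geomRep w (simpleRoot i)}

/-- The positive roots: the roots all of whose coordinates in the simple roots are nonnegative. -/
def posRoots : Set (B → ℝ) := {v ∈ cs.roots | ∀ i, 0 ≤ v i}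

/-- The matroid `M_Φ` of the vector configuration `Φ⁺`. -/
noncomputable def rootMatroid : Matroid (B → ℝ) := Bergman.linearMatroid cs.posRoots

/-- The Tits cone `T = ⋃_w w(R)` in the dual space `V*`, where `R = {f | f(α_i) ≥ 0 for all i}` is
the closed fundamental chamber and `W` acts on `V*` by `w f = f ∘ w⁻¹`. -/
def titsCone : Set (Module.Dual ℝ (B → ℝ)) :=
  {f | ∃ w : W, ∀ i, 0 ≤ f (cs.geomRep w (simpleRoot i))}

/-- A flat `F` of `M_Φ` is parabolic if `X_F ∩ T` has the same dimension as
`X_F = {f ∈ V* | f = 0 on F}`, i.e. if `X_F ∩ T` spans `X_F`. -/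
def IsParabolicFlat (F : Set (B → ℝ)) : Prop :=
  cs.rootMatroid.IsFlat F ∧
    Submodule.span ℝ (((Submodule.span ℝ F).dualAnnihilator : Set (Module.Dual ℝ (B → ℝ))) ∩
      cs.titsCone) = (Submodule.span ℝ F).dualAnnihilator

/-- A positive flat of the oriented matroid `M_Φ`: a (parabolic) flat that is the zero set of a
positive covector. The covectors are the sign vectors on `Φ⁺` of the linear functionals
`f ∈ V*`, and such a covector is positive if `f ≥ 0` on `Φ⁺`. -/
def IsPositiveFlat (F : Set (B → ℝ)) : Prop :=
  cs.IsParabolicFlat F ∧ ∃ f : Module.Dual ℝ (B → ℝ),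
    (∀ a ∈ cs.posRoots, 0 ≤ f a) ∧ F = {a ∈ cs.posRoots | f a = 0}

/-- A flag of positive flats `∅ ⊂ F₁ ⊂ ⋯ ⊂ F_k ⊂ Φ⁺`, recorded as the finite chain
`{F₁, …, F_k}`: a simplex (possibly the empty one) of the order complex of the proper part of
the lattice of positive flats, i.e. a cell of the fine subdivision of the positive Bergman
complex. -/
structure PosFlag where
  carrier : Set (Set (B → ℝ))
  finite : carrier.Finite
  positive : ∀ F ∈ carrier, cs.IsPositiveFlat F
  ne_empty : ∀ F ∈ carrier, F ≠ ∅
  ne_ground : ∀ F ∈ carrier, F ≠ cs.posRoots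
  chain : IsChain (· ⊆ ·) carrier

/-- The matroid `M_𝓕` of a flag of positive flats. -/
noncomputable def PosFlag.matroid {cs : CoxeterSystem M W} (𝓕 : cs.PosFlag) :
    Matroid (B → ℝ) :=
  Bergman.flagMatroid cs.rootMatroid 𝓕.carrier
    (fun F hF => (𝓕.positive F hF).1.1.subset_ground) 𝓕.chain

/-- Two flags are equivalent if they have the same matroid `M_𝓕`. -/
def coarseSetoid : Setoid cs.PosFlag where
  r 𝓕 𝓖 := 𝓕.matroid = 𝓖.matroid
  iseqv := ⟨fun _ => rfl, fun h => h.symm, fun h h' => h.trans h'⟩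

/-- The cells of the coarse subdivision of the positive Bergman complex `B⁺(M_Φ)`: the classes of
flags of positive flats with the same matroid `M_𝓕`. A class stands for the union of the open
simplices of its members; the class of the empty flag is included. -/
def CoarseCell : Type _ := Quotient cs.coarseSetoid

/-- The coarse cell that contains the open simplex of the flag `𝓕`. -/
def coarseCell (𝓕 : cs.PosFlag) : cs.CoarseCell := Quotient.mk cs.coarseSetoid 𝓕

/-- The face order on coarse cells: `c ≤ d` iff `c` lies in the closure of `d`, i.e. every open
simplex of `c` is a face of some simplex of `d`. -/
instance : Preorder cs.CoarseCell where
  le c d := ∀ 𝓕 : cs.PosFlag, cs.coarseCell 𝓕 = c →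
    ∃ 𝓖 : cs.PosFlag, cs.coarseCell 𝓖 = d ∧ 𝓕.carrier ⊆ 𝓖.carrier
  le_refl c := fun 𝓕 h => ⟨𝓕, h, Subset.rfl⟩
  le_trans a b c := fun hab hbc 𝓕 h => by
    obtain ⟨𝓖, h𝓖, hs⟩ := hab 𝓕 h
    obtain ⟨𝓗, h𝓗, hs'⟩ := hbc 𝓖 h𝓖
    exact ⟨𝓗, h𝓗, hs.trans hs'⟩

end CoxeterSystem

/-! ### Tubings and graph associahedra -/

namespace GraphAssoc

open Set

variable {ι : Type*}

/-- A tube of a connected graph: a proper nonempty set of nodes whose induced graph is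
connected. -/
def IsTube (G : SimpleGraph ι) (t : Set ι) : Prop :=
  t.Nonempty ∧ t ≠ univ ∧ (G.induce t).Connected

/-- Two tubes intersect if they meet and neither contains the other. -/
def TubesIntersect (t u : Set ι) : Prop := (t ∩ u).Nonempty ∧ ¬ t ⊆ u ∧ ¬ u ⊆ t

/-- Two tubes are adjacent if they are disjoint and their union induces a connected graph. -/
def TubesAdjacent (G : SimpleGraph ι) (t u : Set ι) : Prop :=
  t ∩ u = ∅ ∧ (G.induce (t ∪ u)).Connected

/-- The tubings of a connected graph: the sets of tubes that are pairwise compatible, i.e. neither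
intersecting nor adjacent. They are ordered by containment. -/
abbrev Tubing (G : SimpleGraph ι) : Type _ :=
  {T : Set (Set ι) // (∀ t ∈ T, IsTube G t) ∧
    T.Pairwise fun t u => ¬ TubesIntersect t u ∧ ¬ TubesAdjacent G t u}

/-- `Q'` is obtained from the polytope `Q` by truncating its face `F`: it is cut off by a hyperplane
that has the vertices of `F` strictly on one side and all other vertices of `Q` strictly on
the other. -/
def IsTruncation (Q F Q' : Set (ι → ℝ)) : Prop :=
  ∃ (l : (ι → ℝ) →ₗ[ℝ] ℝ) (c : ℝ),
    (∀ x ∈ Q.extremePoints ℝ, x ∈ F → l x < c) ∧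
    (∀ x ∈ Q.extremePoints ℝ, x ∉ F → c < l x) ∧
    Q' = {x ∈ Q | c ≤ l x}

/-- `P` is obtained from `Q`, a truncation of the standard simplex, by truncating successively, for
`t` running through the list, the face that corresponds to the set `t` of nodes: what is left of
the face `⋂_{i ∈ t} {x_i = 0}` of the simplex. -/
inductive IsIteratedTruncation : Set (ι → ℝ) → List (Set ι) → Set (ι → ℝ) → Prop
  | nil (Q : Set (ι → ℝ)) : IsIteratedTruncation Q [] Q
  | cons (Q Q' P : Set (ι → ℝ)) (t : Set ι) (L : List (Set ι))
      (h : IsTruncation Q {x ∈ Q | ∀ i ∈ t, x i = 0} Q')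
      (h' : IsIteratedTruncation Q' L P) : IsIteratedTruncation Q (t :: L) P

/-- `P` is a graph associahedron of the connected graph `G`: it is obtained from the simplex whose
facets `x_i = 0` correspond to the nodes `i` of `G` by truncating all the faces that
correspond to tubes, in (weakly) increasing order of dimension of these faces, i.e. in
decreasing order of the size of the tubes. -/
def IsGraphAssociahedron [Finite ι] (G : SimpleGraph ι) (P : Set (ι → ℝ)) : Prop :=
  ∃ L : List (Set ι), L.Nodup ∧ (∀ t, t ∈ L ↔ IsTube G t) ∧
    L.Pairwise (fun t u => u.ncard ≤ t.ncard) ∧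
    IsIteratedTruncation
      {x : ι → ℝ | (∀ i, 0 ≤ x i) ∧ ∑ᶠ i, x i = 1} L P

/-- The poset of nonempty faces of a polytope (the polytope itself included), ordered by
inclusion. -/
abbrev Face {E : Type*} [AddCommGroup E] [Module ℝ E] [TopologicalSpace E] (P : Set E) : Type _ :=
  {F : Set E // F.Nonempty ∧ IsExposed ℝ P F}

end GraphAssoc

/-! Both sides of the duality are identified with the poset of tubings of the diagram `Γ`.

Bergman side. A functional that is nonnegative on `Φ⁺` vanishes on a positive root exactly when it
vanishes on every simple root in its support. So the positive flats are the sets `Φ⁺_J` of positive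
roots with support in `J ⊆ S`, and flags are chains of proper nonempty subsets of `S`. A basis of
`M_𝓕` is an independent set of positive roots that spans `Φ⁺_J`, using its members in `Φ⁺_J`, for
every `J` in the chain and for `J = S`. Positive roots have connected support
(`connected_support_of_mem_posRoots`), so spanning can be tested on the components of `J`, and `M_𝓕`
depends only on the components of the members. Conversely, every connected set of nodes is the
support of a positive root (`exists_posRoot_support_eq`). This yields, for a connected `t` that is
not such a component, a basis of `M_𝓕` that does not span `Φ⁺_t`
(`exists_isBase_not_spansParabolic`), so `M_𝓕` determines the components. Those that are not
components of `Γ` form a tubing. A chain with all its components in a tubing, up to components of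
`Γ`, refines to one that realizes the whole tubing (`exists_chain_comps_eq`). This gives
surjectivity onto the tubings and matches the closure order with containment.

Polytope side. The nonempty faces of a polytope correspond, with order reversed, to its active sets:
the sets of inequalities tight at a point (`nonempty_orderIso_face`). A truncation changes the
active sets in a way that does not depend on the cutting hyperplane (`mem_activeSets_addIneq`).
After the simplex has been truncated at the tubes in `𝓛`, a set of labels is active iff its tube
labels lie in `𝓛` and no member of `𝓛`, nor the set of all nodes, is covered by the nodes in it
together with the properly smaller tubes in it (`nested_insert_iff`). Once all tubes are used, this
describes exactly the tubings (`nested_isTube_iff`). For disconnected `Γ` both tubings and faces are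
products over the components. -/

/-! ### Connected sets of nodes and connected components -/

namespace GraphAssoc

open Set

variable {V : Type*} {G : SimpleGraph V}

/-- `t` is (the node set of) a connected component of the subgraph induced by `J`. -/
def IsComp (G : SimpleGraph V) (J t : Set V) : Prop :=
  t ⊆ J ∧ (G.induce t).Connected ∧ ∀ a ∈ t, ∀ b ∈ J, G.Adj a b → b ∈ t

lemma subset_of_connected_of_closed {u t : Set V} (hu : (G.induce u).Connected)
    (hne : (u ∩ t).Nonempty) (ht : ∀ a ∈ t, ∀ b ∈ u, G.Adj a b → b ∈ t) : u ⊆ t := by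
  intro y hy
  obtain ⟨x, hxu, hxt⟩ := hne
  by_contra hyt
  obtain ⟨p⟩ := hu.preconnected ⟨x, hxu⟩ ⟨y, hy⟩
  obtain ⟨d, -, hd1, hd2⟩ := p.exists_boundary_dart {z | z.1 ∈ t} hxt hyt
  exact hd2 (ht _ hd1 _ d.snd.2 d.adj)

lemma exists_adj_of_connected_of_not_subset {u t : Set V} (hu : (G.induce u).Connected)
    (hne : (u ∩ t).Nonempty) (h : ¬ u ⊆ t) : ∃ a ∈ t ∩ u, ∃ b ∈ u \ t, G.Adj a b := by
  by_contra! hcon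
  refine h fun x hx => (subset_of_connected_of_closed (t := t ∩ u) hu ?_ ?_ hx).1
  · obtain ⟨x, hx⟩ := hne
    exact ⟨x, hx.1, hx.2, hx.1⟩
  · intro a ha b hb hab
    by_contra hbt
    exact hcon a ha b ⟨hb, fun h => hbt ⟨h, hb⟩⟩ hab

lemma nonempty_of_connected {t : Set V} (ht : (G.induce t).Connected) : t.Nonempty :=
  nonempty_coe_sort.1 ht.nonempty

lemma connected_union_of_adj {t u : Set V} (ht : (G.induce t).Connected)
    (hu : (G.induce u).Connected) {a b : V} (ha : a ∈ t) (hb : b ∈ u) (hab : G.Adj a b) :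
    (G.induce (t ∪ u)).Connected :=
  G.connected_induce_union ht.preconnected hu.preconnected ha hb hab

lemma connected_union_of_inter {t u : Set V} (ht : (G.induce t).Connected)
    (hu : (G.induce u).Connected) (h : (t ∩ u).Nonempty) : (G.induce (t ∪ u)).Connected :=
  G.induce_union_connected ht.preconnected hu.preconnected h

lemma connected_singleton (a : V) : (G.induce {a}).Connected := by
  have : Nonempty ({a} : Set V) := ⟨⟨a, rfl⟩⟩
  refine ⟨fun x y => ?_⟩
  rw [Subsingleton.elim x y]

lemma IsComp.nonempty {J t : Set V} (h : IsComp G J t) : t.Nonempty := nonempty_of_connected h.2.1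

lemma IsComp.subset_of_inter {J t u : Set V} (h : IsComp G J t) (hu : (G.induce u).Connected)
    (huJ : u ⊆ J) (hne : (u ∩ t).Nonempty) : u ⊆ t :=
  subset_of_connected_of_closed hu hne fun a ha b hb hab => h.2.2 a ha b (huJ hb) hab

lemma IsComp.eq_of_inter {J t u : Set V} (h : IsComp G J t) (h' : IsComp G J u)
    (hne : (u ∩ t).Nonempty) : u = t :=
  (h.subset_of_inter h'.2.1 h'.1 hne).antisymm
    (h'.subset_of_inter h.2.1 h.1 (by rwa [inter_comm]))

lemma isComp_self {t : Set V} (h : (G.induce t).Connected) : IsComp G t t :=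
  ⟨Subset.rfl, h, fun _ _ _ hb _ => hb⟩

lemma IsComp.eq_self {J t : Set V} (h : IsComp G J t) (hJ : (G.induce J).Connected) : t = J :=
  h.1.antisymm (h.subset_of_inter hJ Subset.rfl (by
    rw [inter_eq_right.2 h.1]; exact h.nonempty))

lemma exists_isComp_of_connected [Finite V] {J u : Set V} (hu : (G.induce u).Connected)
    (huJ : u ⊆ J) : ∃ t, IsComp G J t ∧ u ⊆ t := by
  obtain ⟨t, hut, ht⟩ := (Set.toFinite
    {t : Set V | t ⊆ J ∧ (G.induce t).Connected}).exists_le_maximal (a := u) ⟨huJ, hu⟩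
  refine ⟨t, ⟨ht.prop.1, ht.prop.2, fun a ha b hb hab => ?_⟩, hut⟩
  exact ht.le_of_ge (y := t ∪ {b}) ⟨union_subset ht.prop.1 (by simpa using hb),
    connected_union_of_adj ht.prop.2 (connected_singleton b) ha rfl hab⟩ subset_union_left (by simp)

lemma exists_isComp [Finite V] {J : Set V} {a : V} (ha : a ∈ J) : ∃ t, IsComp G J t ∧ a ∈ t := by
  obtain ⟨t, ht, hat⟩ := exists_isComp_of_connected (G := G) (connected_singleton a)
    (singleton_subset_iff.2 ha)
  exact ⟨t, ht, hat rfl⟩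

/-- Compatibility of tubes. -/
def Compat (G : SimpleGraph V) (t u : Set V) : Prop :=
  ¬ TubesIntersect t u ∧ ¬ TubesAdjacent G t u

lemma compat_of_subset {t u : Set V} (ht : t.Nonempty) (h : t ⊆ u) : Compat G t u :=
  ⟨fun h' => h'.2.1 h, fun h' => ht.ne_empty (by rw [← h'.1, inter_eq_left.2 h])⟩

lemma Compat.symm {t u : Set V} (h : Compat G t u) : Compat G u t :=
  ⟨fun h' => h.1 ⟨by rw [inter_comm]; exact h'.1, h'.2.2, h'.2.1⟩,
   fun h' => h.2 ⟨by rw [inter_comm]; exact h'.1, by rw [union_comm]; exact h'.2⟩⟩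

/-- Compatible connected sets are nested, or disjoint without an edge between them. -/
lemma Compat.trichotomy {t u : Set V} (h : Compat G t u) (ht : (G.induce t).Connected)
    (hu : (G.induce u).Connected) :
    t ⊆ u ∨ u ⊆ t ∨ (t ∩ u = ∅ ∧ ∀ a ∈ t, ∀ b ∈ u, ¬ G.Adj a b) := by
  by_cases h1 : t ⊆ u
  · exact .inl h1
  by_cases h2 : u ⊆ t
  · exact .inr (.inl h2)
  have h3 : t ∩ u = ∅ := by
    by_contra h3
    exact h.1 ⟨nonempty_iff_ne_empty.2 h3, h1, h2⟩
  exact .inr (.inr ⟨h3, fun a ha b hb hab => h.2 ⟨h3, connected_union_of_adj ht hu ha hb hab⟩⟩)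

lemma compat_of_no_edge {t u : Set V} (ht : t.Nonempty) (hu : u.Nonempty) (h : t ∩ u = ∅)
    (hadj : ∀ a ∈ t, ∀ b ∈ u, ¬ G.Adj a b) : Compat G t u := by
  refine ⟨fun h' => h'.1.ne_empty h, fun h' => ?_⟩
  have hsub : t ∪ u ⊆ t := subset_of_connected_of_closed h'.2
    (by obtain ⟨x, hx⟩ := ht; exact ⟨x, .inl hx, hx⟩)
    (fun a ha b hb hab => hb.resolve_right fun hb => hadj a ha b hb hab)
  obtain ⟨x, hx⟩ := hu
  exact (h.subset ⟨hsub (.inr hx), hx⟩ : x ∈ (∅ : Set V))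

/-- Components of nested sets are compatible. -/
lemma IsComp.compat_of_subset {J K t u : Set V} (ht : IsComp G J t) (hu : IsComp G K u)
    (hJK : J ⊆ K) : Compat G t u := by
  by_cases hne : (t ∩ u).Nonempty
  · exact GraphAssoc.compat_of_subset ht.nonempty
      (hu.subset_of_inter ht.2.1 (ht.1.trans hJK) hne)
  · rw [not_nonempty_iff_eq_empty] at hne
    refine compat_of_no_edge ht.nonempty hu.nonempty hne fun a ha b hb hab => ?_
    exact (hne.subset ⟨ha, hu.2.2 b hb a (hJK (ht.1 ha)) hab.symm⟩ : a ∈ (∅ : Set V))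

/-- The set of components of the members of a family of sets of nodes. -/
def comps (G : SimpleGraph V) (𝓒 : Set (Set V)) : Set (Set V) := {t | ∃ J ∈ 𝓒, IsComp G J t}

lemma comps_mono {𝓒 𝓓 : Set (Set V)} (h : 𝓒 ⊆ 𝓓) : comps G 𝓒 ⊆ comps G 𝓓 :=
  fun _ ⟨J, hJ, ht⟩ => ⟨J, h hJ, ht⟩

lemma comps_compat {𝓒 : Set (Set V)} (h : IsChain (· ⊆ ·) 𝓒) {t u : Set V}
    (ht : t ∈ comps G 𝓒) (hu : u ∈ comps G 𝓒) : Compat G t u := by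
  obtain ⟨J, hJ, ht⟩ := ht
  obtain ⟨K, hK, hu⟩ := hu
  rcases h.total hJ hK with h | h
  · exact ht.compat_of_subset hu h
  · exact (hu.compat_of_subset ht h).symm

/-- Tubings of an arbitrary graph: families of pairwise compatible connected sets, none of which is
a component of the graph. -/
abbrev GTubing (G : SimpleGraph V) : Type _ :=
  {T : Set (Set V) // (∀ t ∈ T, (G.induce t).Connected ∧ ¬ IsComp G univ t) ∧
    T.Pairwise (Compat G)}

/-- The components of `K ∪ t`, for `t` compatible with the components of `K`. -/
lemma isComp_union [Finite V] {K t c : Set V} (ht : (G.induce t).Connected)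
    (hK : ∀ u, IsComp G K u → Compat G u t) (htK : ¬ t ⊆ K) (hc : IsComp G (K ∪ t) c) :
    c = t ∨ IsComp G K c := by
  -- `t ⊆ u` is impossible since it would put `t` inside `K`. Hence the components of `K` that touch
  -- `t` are swallowed by it, and `t` is a component of `K ∪ t`.
  have key : ∀ u, IsComp G K u → u ⊆ t ∨ (u ∩ t = ∅ ∧ ∀ a ∈ u, ∀ b ∈ t, ¬ G.Adj a b) := by
    intro u hu
    rcases (hK u hu).trichotomy hu.2.1 ht with h | h | h
    · exact .inl h
    · exact absurd (h.trans hu.1) htK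
    · exact .inr h
  have htc : IsComp G (K ∪ t) t := by
    refine ⟨subset_union_right, ht, fun a ha b hb hab => ?_⟩
    rcases hb with hb | hb
    · obtain ⟨u, hu, hbu⟩ := exists_isComp (G := G) hb
      rcases key u hu with h | h
      · exact h hbu
      · exact absurd hab.symm (h.2 b hbu a ha)
    · exact hb
  by_cases hne : (c ∩ t).Nonempty
  · exact .inl (htc.eq_of_inter hc hne)
  · right
    rw [not_nonempty_iff_eq_empty] at hne
    refine ⟨fun x hx => (hc.1 hx).resolve_right fun h =>
      (hne.subset ⟨hx, h⟩ : x ∈ (∅ : Set V)), hc.2.1, fun a ha b hb hab =>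
      hc.2.2 a ha b (.inl hb) hab⟩

/-- A chain whose components belong to a tubing can be refined to a chain whose components are
the whole tubing. -/
lemma exists_chain_comps_eq [Finite V] (T : GTubing G) (𝓒 : Set (Set V))
    (h𝓒 : IsChain (· ⊆ ·) 𝓒) (hne : ∀ J ∈ 𝓒, J ≠ ∅ ∧ J ≠ univ)
    (hT : comps G 𝓒 ⊆ T.1 ∪ {t | IsComp G univ t}) :
    ∃ 𝓓 : Set (Set V), 𝓒 ⊆ 𝓓 ∧ IsChain (· ⊆ ·) 𝓓 ∧ (∀ J ∈ 𝓓, J ≠ ∅ ∧ J ≠ univ) ∧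
      comps G (insert univ 𝓓) = T.1 ∪ {t | IsComp G univ t} := by
  -- A maximal admissible chain works: if a tube `t` of `T` were missing, the chain could be
  -- enlarged by `K ∪ t`, with `K` its largest member not containing `t`.
  obtain ⟨𝓓, h𝓒𝓓, hmax⟩ := (Set.toFinite {𝓓 : Set (Set V) | IsChain (· ⊆ ·) 𝓓 ∧
    (∀ J ∈ 𝓓, J ≠ ∅ ∧ J ≠ univ) ∧ comps G 𝓓 ⊆ T.1 ∪ {t | IsComp G univ t}}).exists_le_maximal
    (a := 𝓒) ⟨h𝓒, hne, hT⟩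
  obtain ⟨hchain, hne', hsub⟩ := hmax.prop
  refine ⟨𝓓, h𝓒𝓓, hchain, hne', Subset.antisymm ?_ ?_⟩
  · rintro t ⟨J, rfl | hJ, ht⟩
    · exact .inr ht
    · exact hsub ⟨J, hJ, ht⟩
  rintro t (ht | ht)
  swap
  · exact ⟨univ, mem_insert _ _, ht⟩
  by_contra htD
  have htconn := (T.2.1 t ht).1
  have hTcompat : ∀ u ∈ T.1 ∪ {t | IsComp G univ t}, Compat G u t := by
    rintro u (hu | hu)
    · by_cases hut : u = t
      · subst hut; exact compat_of_subset (nonempty_of_connected htconn) Subset.rfl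
      · exact T.2.2 hu ht hut
    · exact ((isComp_self htconn).compat_of_subset hu (subset_univ _)).symm
  -- the union of the members of the chain that do not contain `t`
  set K : Set V := ⋃₀ {J ∈ 𝓓 | ¬ t ⊆ J} with hKdef
  have hK : K = ∅ ∨ K ∈ {J ∈ 𝓓 | ¬ t ⊆ J} := by
    rcases eq_empty_or_nonempty {J ∈ 𝓓 | ¬ t ⊆ J} with h | h
    · left; rw [hKdef, h, sUnion_empty]
    · obtain ⟨m, hm⟩ := (Set.toFinite {J ∈ 𝓓 | ¬ t ⊆ J}).exists_maximal h
      right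
      have : K = m := by
        refine Subset.antisymm (sUnion_subset fun J hJ => ?_) (subset_sUnion_of_mem hm.prop)
        rcases hchain.total hJ.1 hm.prop.1 with h | h
        · exact h
        · exact hm.le_of_ge hJ h
      rw [this]; exact hm.prop
  have htK : ¬ t ⊆ K := by
    rcases hK with h | h
    · rw [h]; exact fun h' => (nonempty_of_connected htconn).ne_empty (subset_empty_iff.1 h')
    · exact h.2
  have hKcomp : ∀ u, IsComp G K u → u ∈ T.1 ∪ {t | IsComp G univ t} := by
    intro u hu
    rcases hK with h | h
    · exact absurd (subset_empty_iff.1 (h ▸ hu.1)) hu.nonempty.ne_empty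
    · exact hsub ⟨K, h.1, hu⟩
  have hcomp : ∀ c, IsComp G (K ∪ t) c → c = t ∨ IsComp G K c := fun c hc =>
    isComp_union htconn (fun u hu => hTcompat u (hKcomp u hu)) htK hc
  -- If `K ∪ t` were already present, its component containing `t` would be `t` itself, which is
  -- missing, or a component of `K`, which does not contain `t`.
  have hnc : ∀ J ∈ insert univ 𝓓, K ∪ t ≠ J := by
    rintro J hJ rfl
    obtain ⟨c, hc, htc⟩ := exists_isComp_of_connected (J := K ∪ t) htconn subset_union_right
    rcases hcomp c hc with rfl | hc'
    · exact htD ⟨_, hJ, hc⟩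
    · exact htK (htc.trans hc'.1)
  have hmem : K ∪ t ∈ 𝓓 := by
    refine hmax.le_of_ge (y := insert (K ∪ t) 𝓓) ⟨?_, ?_, ?_⟩ (subset_insert _ _) (mem_insert _ _)
    -- Members that contain `t` also contain `K`; all others are contained in `K`.
    · refine hchain.insert fun J hJ _ => ?_
      by_cases htJ : t ⊆ J
      · left
        refine union_subset ?_ htJ
        rcases hK with h | h
        · rw [h]; exact empty_subset _
        · exact (hchain.total h.1 hJ).resolve_right fun h' => h.2 (htJ.trans h')
      · right
        exact (subset_sUnion_of_mem (⟨hJ, htJ⟩ : J ∈ {J ∈ 𝓓 | ¬ t ⊆ J})).trans subset_union_left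
    · rintro J (rfl | hJ)
      · refine ⟨?_, hnc univ (mem_insert _ _)⟩
        obtain ⟨x, hx⟩ := nonempty_of_connected htconn
        exact Nonempty.ne_empty ⟨x, .inr hx⟩
      · exact hne' J hJ
    · rintro c ⟨J, rfl | hJ, hc⟩
      · rcases hcomp c hc with rfl | hc
        · exact .inl ht
        · exact hKcomp c hc
      · exact hsub ⟨J, hJ, hc⟩
  exact hnc _ (mem_insert_of_mem _ hmem) rfl

/-! ### Tubings of connected graphs and of disjoint unions -/

lemma isComp_univ_iff_of_connected (hG : G.Connected) {t : Set V} :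
    IsComp G univ t ↔ t = univ := by
  have h : (G.induce univ).Connected := (SimpleGraph.induceUnivIso G).connected_iff.2 hG
  exact ⟨fun ht => ht.eq_self h, fun ht => by rw [ht]; exact isComp_self h⟩

lemma isTube_iff_of_connected (hG : G.Connected) {t : Set V} :
    IsTube G t ↔ (G.induce t).Connected ∧ ¬ IsComp G univ t := by
  rw [isComp_univ_iff_of_connected hG]
  exact ⟨fun h => ⟨h.2.2, h.2.1⟩, fun h => ⟨nonempty_of_connected h.1, h.2, h.1⟩⟩

/-- For a connected graph, the two notions of tubing agree. -/
def gTubingEquivTubing (hG : G.Connected) : GTubing G ≃o Tubing G where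
  toEquiv := Equiv.subtypeEquivRight fun T => by
    simp only [isTube_iff_of_connected hG]
    rfl
  map_rel_iff' := Iff.rfl

lemma connected_induce_image {s : Set V} (t : Set s) :
    (G.induce (Subtype.val '' t)).Connected ↔ ((G.induce s).induce t).Connected := by
  let e : (G.induce s).induce t ≃g G.induce (Subtype.val '' t) :=
    { toEquiv := Equiv.Set.image _ t Subtype.val_injective
      map_rel_iff' := Iff.rfl }
  exact e.connected_iff.symm

lemma compat_image {s : Set V} (t u : Set s) :
    Compat G (Subtype.val '' t) (Subtype.val '' u) ↔ Compat (G.induce s) t u := by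
  have hinj := Subtype.val_injective (p := (· ∈ s))
  rw [Compat, Compat, TubesIntersect, TubesIntersect, TubesAdjacent, TubesAdjacent,
    ← image_inter hinj, ← image_union, connected_induce_image, image_nonempty, image_eq_empty,
    image_subset_image_iff hinj, image_subset_image_iff hinj]

lemma isComp_supp (C : G.ConnectedComponent) : IsComp G univ C.supp :=
  ⟨subset_univ _, C.maximal_connected_induce_supp.prop, fun a ha b _ hab => by
    rw [SimpleGraph.ConnectedComponent.mem_supp_iff] at ha ⊢
    rw [← ha]; exact (SimpleGraph.ConnectedComponent.connectedComponentMk_eq_of_adj hab).symm⟩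

lemma exists_subset_supp {t : Set V} (ht : (G.induce t).Connected) :
    ∃ C : G.ConnectedComponent, t ⊆ C.supp := by
  obtain ⟨x, hx⟩ := nonempty_of_connected ht
  exact ⟨G.connectedComponentMk x, (isComp_supp _).subset_of_inter ht (subset_univ _) ⟨x, hx, rfl⟩⟩

lemma connected_induce_supp (C : G.ConnectedComponent) : (G.induce C.supp).Connected :=
  (isComp_supp C).2.1

lemma isTube_induce_supp_iff (C : G.ConnectedComponent) (t : Set C.supp) :
    IsTube (G.induce C.supp) t ↔ (G.induce (Subtype.val '' t)).Connected ∧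
      ¬ IsComp G univ (Subtype.val '' t) := by
  rw [connected_induce_image]
  refine ⟨fun h => ⟨h.2.2, fun hc => h.2.1 ?_⟩, fun h => ⟨nonempty_of_connected h.1, ?_, h.1⟩⟩
  · have := (isComp_supp C).eq_of_inter hc (by
      obtain ⟨x, hx⟩ := h.1
      exact ⟨x, ⟨x, hx, rfl⟩, x.2⟩)
    apply Subtype.val_injective.image_injective
    rw [this, image_univ, Subtype.range_val]
  · rintro rfl
    exact h.2 (by rw [image_univ, Subtype.range_val]; exact isComp_supp C)

/-- A tubing is a tuple of tubings of the connected components. -/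
def gTubingEquivPi : GTubing G ≃o ∀ C : G.ConnectedComponent, Tubing (G.induce C.supp) where
  toFun T C := ⟨{t | Subtype.val '' t ∈ T.1},
    fun t ht => (isTube_induce_supp_iff C t).2 (T.2.1 _ ht), fun t ht u hu htu =>
      (compat_image t u).1 (T.2.2 ht hu (Subtype.val_injective.image_injective.ne htu))⟩
  invFun S := ⟨{t | ∃ C, ∃ t' ∈ (S C).1, t = Subtype.val '' t'}, by
      rintro _ ⟨C, t', ht', rfl⟩
      exact (isTube_induce_supp_iff C t').1 ((S C).2.1 t' ht'), by
      rintro _ ⟨C, t, ht, rfl⟩ _ ⟨D, u, hu, rfl⟩ hne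
      by_cases hCD : C = D
      · subst hCD
        exact (compat_image t u).2 ((S C).2.2 ht hu fun h => hne (by rw [h]))
      · have hdisj : ∀ x ∈ C.supp, x ∉ D.supp := fun x hx hx' => hCD (by
          rw [SimpleGraph.ConnectedComponent.mem_supp_iff] at hx hx'; rw [← hx, hx'])
        refine compat_of_no_edge (((S C).2.1 t ht).1.image _) (((S D).2.1 u hu).1.image _) ?_ ?_
        · rw [eq_empty_iff_forall_notMem]
          rintro _ ⟨⟨x, -, rfl⟩, ⟨y, -, hy⟩⟩
          exact hdisj x x.2 (hy ▸ y.2)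
        · rintro _ ⟨x, -, rfl⟩ _ ⟨y, -, rfl⟩ hadj
          exact hdisj y ((isComp_supp C).2.2 x x.2 y (mem_univ _) hadj) y.2⟩
  left_inv T := by
    apply Subtype.ext
    ext t
    constructor
    · rintro ⟨C, t', ht', rfl⟩
      exact ht'
    · intro ht
      obtain ⟨C, hC⟩ := exists_subset_supp (T.2.1 t ht).1
      have : Subtype.val '' (Subtype.val ⁻¹' t : Set C.supp) = t := by
        rw [Subtype.image_preimage_coe, inter_eq_right.2 hC]
      exact ⟨C, Subtype.val ⁻¹' t, by rw [mem_ofPred_eq, this]; exact ht, this.symm⟩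
  right_inv S := by
    funext C
    apply Subtype.ext
    ext t
    constructor
    · rintro ⟨D, u, hu, htu⟩
      obtain ⟨x, hx⟩ := ((S D).2.1 u hu).1
      have hxC : (x : V) ∈ C.supp := by
        have : (x : V) ∈ (Subtype.val '' t : Set V) := htu ▸ ⟨x, hx, rfl⟩
        obtain ⟨y, -, hy⟩ := this
        exact hy ▸ y.2
      have hCD : C = D := by
        have h1 := x.2
        rw [SimpleGraph.ConnectedComponent.mem_supp_iff] at hxC h1
        rw [← hxC, h1]
      subst hCD
      rwa [Subtype.val_injective.image_injective htu]
    · intro ht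
      exact ⟨C, t, ht, rfl⟩
  map_rel_iff' {T T'} := by
    constructor
    · intro h t ht
      obtain ⟨C, hC⟩ := exists_subset_supp (T.2.1 t ht).1
      have : Subtype.val '' (Subtype.val ⁻¹' t : Set C.supp) = t := by
        rw [Subtype.image_preimage_coe, inter_eq_right.2 hC]
      have h2 := h C (show (Subtype.val ⁻¹' t : Set C.supp) ∈ {t | Subtype.val '' t ∈ T.1} by
        rw [mem_ofPred_eq, this]; exact ht)
      change Subtype.val '' (Subtype.val ⁻¹' t : Set C.supp) ∈ T'.1 at h2
      rwa [this] at h2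
    · intro h C t ht
      exact h ht

end GraphAssoc

/-! ### Polyhedra: active sets of inequalities, faces and truncations -/

namespace GraphAssoc

open Set Filter Topology

section Polyhedron

variable {E : Type*} [NormedAddCommGroup E] [NormedSpace ℝ E]
variable {A : Type*} {H : AffineSubspace ℝ E} {g : A → E →ᵃ[ℝ] ℝ}

/-- The polyhedron in the affine subspace `H` defined by the inequalities `0 ≤ g a`. -/
def polyhedron (H : AffineSubspace ℝ E) (g : A → E →ᵃ[ℝ] ℝ) : Set E :=
  {x | x ∈ H ∧ ∀ a, 0 ≤ g a x}

/-- The indices of the inequalities that are tight at `x`. -/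
def active (g : A → E →ᵃ[ℝ] ℝ) (x : E) : Set A := {a | g a x = 0}

/-- The active sets of the points of a polyhedron. -/
def activeSets (H : AffineSubspace ℝ E) (g : A → E →ᵃ[ℝ] ℝ) : Set (Set A) :=
  active g '' polyhedron H g

/-- The face of a polyhedron on which the inequalities in `σ` are tight. -/
def faceOf (H : AffineSubspace ℝ E) (g : A → E →ᵃ[ℝ] ℝ) (σ : Set A) : Set E :=
  {x ∈ polyhedron H g | σ ⊆ active g x}

lemma apply_lineMap_real (h : E →ᵃ[ℝ] ℝ) (x y : E) (r : ℝ) :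
    h (AffineMap.lineMap x y r) = (1 - r) * h x + r * h y := by
  rw [AffineMap.apply_lineMap, AffineMap.lineMap_apply_ring]

lemma lineMap_mem_polyhedron {x y : E} (hx : x ∈ polyhedron H g) (hy : y ∈ polyhedron H g) {r : ℝ}
    (h0 : 0 ≤ r) (h1 : r ≤ 1) : AffineMap.lineMap x y r ∈ polyhedron H g := by
  refine ⟨AffineMap.lineMap_mem r hx.1 hy.1, fun a => ?_⟩
  rw [apply_lineMap_real]
  exact add_nonneg (mul_nonneg (sub_nonneg.2 h1) (hx.2 a)) (mul_nonneg h0 (hy.2 a))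

/-- A combination of two nonnegative numbers with positive weights vanishes only if both vanish. -/
lemma active_lineMap {x y : E} (hx : x ∈ polyhedron H g) (hy : y ∈ polyhedron H g) {r : ℝ}
    (h0 : 0 < r) (h1 : r < 1) :
    active g (AffineMap.lineMap x y r) = active g x ∩ active g y := by
  ext a
  simp only [active, mem_ofPred_eq, mem_inter_iff, apply_lineMap_real]
  have hr : 0 < 1 - r := sub_pos.2 h1
  rw [add_eq_zero_iff_of_nonneg (mul_nonneg hr.le (hx.2 a)) (mul_nonneg h0.le (hy.2 a)),
    mul_eq_zero_iff_left hr.ne', mul_eq_zero_iff_left h0.ne']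

/-- From a point of the polyhedron one can move a little in every direction along which the
active inequalities stay tight. -/
lemma eventually_lineMap_mem [Finite A] {x y : E} (hx : x ∈ polyhedron H g) (hy : y ∈ H)
    (hxy : active g x ⊆ active g y) :
    ∀ᶠ r in 𝓝 (0 : ℝ), AffineMap.lineMap x y r ∈ polyhedron H g := by
  have : ∀ a, ∀ᶠ r in 𝓝 (0 : ℝ), 0 ≤ g a (AffineMap.lineMap x y r) := by
    intro a
    simp only [apply_lineMap_real]
    by_cases ha : a ∈ active g x
    · have h1 : g a x = 0 := ha
      have h2 : g a y = 0 := hxy ha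
      simp [h1, h2]
    · have hpos : 0 < g a x := lt_of_le_of_ne (hx.2 a) (Ne.symm ha)
      have hc : Continuous fun r : ℝ => (1 - r) * g a x + r * g a y := by fun_prop
      have := hc.tendsto 0
      simp only [sub_zero, one_mul, zero_mul, add_zero] at this
      exact (this.eventually (lt_mem_nhds hpos)).mono fun r hr => hr.le
  filter_upwards [eventually_all.2 this] with r hr
  exact ⟨AffineMap.lineMap_mem r hx.1 hy, hr⟩

/-- Minus the sum of the inequalities in `σ` is at most zero on the polyhedron, with equality
exactly on the face. Taking linear parts only shifts it by a constant. -/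
lemma isExposed_faceOf [FiniteDimensional ℝ E] [Finite A] (σ : Set A) :
    IsExposed ℝ (polyhedron H g) (faceOf H g σ) := by
  rintro ⟨x₀, hx₀, hσ⟩
  set s : Finset A := (Set.toFinite σ).toFinset
  let l : StrongDual ℝ E := -(∑ a ∈ s, LinearMap.toContinuousLinearMap (g a).linear)
  have hl : ∀ x, l x = ∑ a ∈ s, g a 0 - ∑ a ∈ s, g a x := by
    intro x
    have : ∀ a, (g a).linear x = g a x - g a 0 := fun a => by
      have := (g a).linearMap_vsub x 0
      simpa using this
    simp [l, this, Finset.sum_sub_distrib]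
  have hs : ∀ a, a ∈ s ↔ a ∈ σ := fun a => (Set.toFinite σ).mem_toFinset
  have hzero : ∑ a ∈ s, g a x₀ = 0 := Finset.sum_eq_zero fun a ha => hσ ((hs a).1 ha)
  refine ⟨l, ?_⟩
  ext x
  constructor
  · rintro ⟨hx, hxσ⟩
    refine ⟨hx, fun y hy => ?_⟩
    rw [hl, hl, Finset.sum_eq_zero fun a ha => hxσ ((hs a).1 ha)]
    have := Finset.sum_nonneg (s := s) fun a _ => hy.2 a
    linarith
  · rintro ⟨hx, hmax⟩
    refine ⟨hx, fun a ha => ?_⟩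
    have h1 := hmax x₀ hx₀
    rw [hl, hl, hzero] at h1
    have h2 : ∑ a ∈ s, g a x = 0 :=
      le_antisymm (by linarith) (Finset.sum_nonneg fun a _ => hx.2 a)
    exact (Finset.sum_eq_zero_iff_of_nonneg fun a _ => hx.2 a).1 h2 a ((hs a).2 ha)

/-- Take `x₀` in `F` with a minimal active set. For `y` in `F` the midpoint has the intersection of
the two active sets, so minimality makes the inequalities tight at `x₀` tight at `y`. Conversely, if
they are tight at `y`, one can move from `x₀` slightly away from `y`; maximality of `l` at `x₀` then
forces `l` to be maximal at `y` too. -/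
lemma exists_faceOf_eq_of_isExposed [Finite A] {F : Set E} (hne : F.Nonempty)
    (hF : IsExposed ℝ (polyhedron H g) F) : ∃ σ ∈ activeSets H g, F = faceOf H g σ := by
  obtain ⟨l, hl⟩ := hF hne
  obtain ⟨τ, hτ⟩ := (Set.toFinite (active g '' F)).exists_minimal (hne.image _)
  obtain ⟨x₀, hx₀, rfl⟩ := hτ.prop
  have hx₀' : x₀ ∈ polyhedron H g ∧ ∀ y ∈ polyhedron H g, l y ≤ l x₀ := by rw [hl] at hx₀; exact hx₀
  refine ⟨active g x₀, ⟨x₀, hx₀'.1, rfl⟩, Subset.antisymm ?_ ?_⟩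
  · intro y hy
    have hy' : y ∈ polyhedron H g ∧ ∀ z ∈ polyhedron H g, l z ≤ l y := by rw [hl] at hy; exact hy
    refine ⟨hy'.1, ?_⟩
    have hact := active_lineMap hx₀'.1 hy'.1 (r := 1 / 2) (by norm_num) (by norm_num)
    have hmid : AffineMap.lineMap x₀ y (1 / 2 : ℝ) ∈ F := by
      rw [hl]
      refine ⟨lineMap_mem_polyhedron hx₀'.1 hy'.1 (by norm_num) (by norm_num), fun z hz => ?_⟩
      have := apply_lineMap_real l.toLinearMap.toAffineMap x₀ y (1 / 2)
      simp only [LinearMap.coe_toAffineMap, ContinuousLinearMap.coe_coe] at this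
      rw [this]
      have h1 := hx₀'.2 z hz
      have h2 := hy'.2 z hz
      linarith
    have := hτ.le_of_le (mem_image_of_mem _ hmid) (by rw [hact]; exact inter_subset_left)
    exact this.trans (by rw [hact]; exact inter_subset_right)
  · rintro y ⟨hy, hσ⟩
    have hev := (eventually_lineMap_mem hx₀'.1 hy.1 hσ)
    obtain ⟨r, hr, hr0⟩ := (hev.filter_mono nhdsWithin_le_nhds |>.and
      (self_mem_nhdsWithin (s := Iio (0 : ℝ)))).exists
    have h1 := hx₀'.2 _ hr
    have := apply_lineMap_real l.toLinearMap.toAffineMap x₀ y r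
    simp only [LinearMap.coe_toAffineMap, ContinuousLinearMap.coe_coe] at this
    rw [this] at h1
    have hr0' : r < 0 := hr0
    have hle : l x₀ ≤ l y := by nlinarith
    rw [hl]
    exact ⟨hy, fun z hz => (hx₀'.2 z hz).trans hle⟩

/-- The poset of nonempty faces of a polyhedron is dual to the poset of active sets. -/
lemma nonempty_orderIso_face [FiniteDimensional ℝ E] [Finite A] :
    Nonempty (activeSets H g ≃o (Face (polyhedron H g))ᵒᵈ) := by
  let f : activeSets H g → (Face (polyhedron H g))ᵒᵈ := fun σ =>
    OrderDual.toDual ⟨faceOf H g σ.1, by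
      obtain ⟨x, hx, h⟩ := σ.2
      exact ⟨x, hx, h.ge⟩, isExposed_faceOf σ.1⟩
  have hf : ∀ σ τ, f σ ≤ f τ ↔ σ ≤ τ := by
    intro σ τ
    change faceOf H g τ.1 ⊆ faceOf H g σ.1 ↔ σ.1 ⊆ τ.1
    constructor
    · intro h
      obtain ⟨x, hx, hxτ⟩ := τ.2
      rw [← hxτ]
      exact (h ⟨hx, hxτ.ge⟩).2
    · exact fun h x hx => ⟨hx.1, h.trans hx.2⟩
  refine ⟨RelIso.ofSurjective (OrderEmbedding.ofMapLEIff f hf) ?_⟩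
  intro F
  obtain ⟨σ, hσ, hF⟩ := exists_faceOf_eq_of_isExposed (OrderDual.ofDual F).2.1
    (OrderDual.ofDual F).2.2
  exact ⟨⟨σ, hσ⟩, Subtype.ext hF.symm⟩

lemma isClosed_polyhedron [FiniteDimensional ℝ E] : IsClosed (polyhedron H g) := by
  have : polyhedron H g = (H : Set E) ∩ ⋂ a, {x | 0 ≤ g a x} := by
    ext x; simp [polyhedron]
  rw [this]
  exact H.closed_of_finiteDimensional.inter (isClosed_iInter fun a =>
    isClosed_le continuous_const (g a).continuous_of_finiteDimensional)

/-- An affine function attains its maximum on a face of a polytope at a vertex of the polytope. -/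
lemma exists_extremePoint_ge [FiniteDimensional ℝ E] [Finite A]
    (hQ : IsCompact (polyhedron H g)) {σ : Set A} {x : E} (hx : x ∈ faceOf H g σ) (h : E →ᵃ[ℝ] ℝ) :
    ∃ v ∈ (polyhedron H g).extremePoints ℝ, v ∈ faceOf H g σ ∧ h x ≤ h v := by
  have hFc : IsCompact (faceOf H g σ) := (isExposed_faceOf σ).isCompact hQ
  let l : StrongDual ℝ E := LinearMap.toContinuousLinearMap h.linear
  have hl : ∀ x, l x = h x - h 0 := fun x => by
    have := h.linearMap_vsub x 0
    simpa [l] using this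
  -- An extreme point of the subface where `h` is maximal is also an extreme point of the whole
  -- polytope.
  have hK : IsExposed ℝ (faceOf H g σ) (l.toExposed (faceOf H g σ)) :=
    ContinuousLinearMap.toExposed.isExposed
  obtain ⟨m, hm, hmax⟩ := hFc.exists_isMaxOn ⟨x, hx⟩ l.continuous.continuousOn
  obtain ⟨v, hv⟩ := (hK.isCompact hFc).extremePoints_nonempty ⟨m, hm, hmax⟩
  have hvK := extremePoints_subset hv
  refine ⟨v, ((isExposed_faceOf σ).isExtreme.trans
    hK.isExtreme).extremePoints_subset_extremePoints hv, hvK.1, ?_⟩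
  have := hvK.2 x hx
  rw [hl, hl] at this
  linarith

/-- A vertex is determined by its active set: if `y` had the same active set as the vertex `x`, the
segment from `y` could be prolonged beyond `x`. -/
lemma finite_extremePoints [Finite A] : ((polyhedron H g).extremePoints ℝ).Finite := by
  refine Set.Finite.of_finite_image (f := active g) (Set.toFinite _) ?_
  intro x hx y hy hxy
  by_contra hne
  rw [mem_extremePoints] at hx hy
  have hev := eventually_lineMap_mem hx.1 hy.1.1 hxy.le
  obtain ⟨r, hr, hr0⟩ := (hev.filter_mono nhdsWithin_le_nhds |>.and
    (self_mem_nhdsWithin (s := Iio (0 : ℝ)))).exists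
  have hr0' : r < 0 := hr0
  have := (hx.2 _ hr _ hy.1 (by
    rw [openSegment_eq_image_lineMap]
    -- The parameter solves for `x` on the segment from the point `(1 - r) x + r y`, with `r < 0`,
    -- to `y`.
    refine ⟨-r / (1 - r), ⟨div_pos (by linarith) (by linarith), ?_⟩, ?_⟩
    · rw [div_lt_one (by linarith)]; linarith
    · have h1 : (1 - r) ≠ 0 := by linarith
      simp only [AffineMap.lineMap_apply_module, smul_add, smul_smul]
      have e1 : (1 - -r / (1 - r)) * (1 - r) = 1 := by field_simp; ring
      have e2 : (1 - -r / (1 - r)) * r = r / (1 - r) := by field_simp; ring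
      rw [e1, e2, add_assoc, ← add_smul]
      have e3 : r / (1 - r) + -r / (1 - r) = 0 := by ring
      rw [e3]; simp)).2
  exact hne this.symm

/-! ### Truncation by one inequality -/

/-- The inequalities after adding a new one. -/
noncomputable def addIneq (g : A → E →ᵃ[ℝ] ℝ) (s : A) (l : E →ₗ[ℝ] ℝ) (c : ℝ) :
    A → E →ᵃ[ℝ] ℝ :=
  open Classical in Function.update g s (l.toAffineMap - AffineMap.const ℝ E c)

lemma addIneq_self (s : A) (l : E →ₗ[ℝ] ℝ) (c : ℝ) (x : E) : addIneq g s l c s x = l x - c := by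
  simp [addIneq]

lemma addIneq_of_ne {s a : A} (h : a ≠ s) (l : E →ₗ[ℝ] ℝ) (c : ℝ) : addIneq g s l c a = g a := by
  simp [addIneq, h]

/-- An unused label carries the constant inequality `0 ≤ 1`, which is never tight. Overwriting it
loses nothing and keeps the index set fixed through successive truncations. -/
lemma polyhedron_addIneq {s : A} (hs : ∀ x, g s x = 1) (l : E →ₗ[ℝ] ℝ) (c : ℝ) :
    polyhedron H (addIneq g s l c) = {x ∈ polyhedron H g | c ≤ l x} := by
  ext x
  constructor
  · rintro ⟨hx, h⟩
    refine ⟨⟨hx, fun a => ?_⟩, by have := h s; rw [addIneq_self] at this; linarith⟩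
    by_cases ha : a = s
    · rw [ha, hs]; exact zero_le_one
    · have := h a; rwa [addIneq_of_ne ha l c] at this
  · rintro ⟨⟨hx, h⟩, hc⟩
    refine ⟨hx, fun a => ?_⟩
    by_cases ha : a = s
    · rw [ha, addIneq_self]; linarith
    · rw [addIneq_of_ne ha l c]; exact h a

lemma active_addIneq_of_ne {s : A} (hs : ∀ x, g s x = 1) {l : E →ₗ[ℝ] ℝ} {c : ℝ} {x : E}
    (h : l x ≠ c) : active (addIneq g s l c) x = active g x := by
  ext a
  by_cases ha : a = s
  · subst ha
    simp only [active, mem_ofPred_eq, addIneq_self, hs, one_ne_zero, iff_false]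
    exact sub_ne_zero.2 h
  · simp only [active, mem_ofPred_eq, addIneq_of_ne ha]

lemma active_addIneq_of_eq {s : A} {l : E →ₗ[ℝ] ℝ} {c : ℝ} {x : E}
    (h : l x = c) : active (addIneq g s l c) x = insert s (active g x) := by
  ext a
  by_cases ha : a = s
  · subst ha
    simp [active, addIneq_self, h]
  · simp only [active, mem_ofPred_eq, addIneq_of_ne ha, mem_insert_iff, ha, false_or]

/-- The active sets of a truncated polytope: those not containing `σ` survive, and the new
inequality `s` is tight together with those that are jointly active with `σ`. -/
lemma mem_activeSets_addIneq [FiniteDimensional ℝ E] [Finite A]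
    (hQ : IsCompact (polyhedron H g)) {s : A} (hs : ∀ x, g s x = 1) {l : E →ₗ[ℝ] ℝ}
    {c : ℝ} {σ : Set A}
    (hlt : ∀ x ∈ (polyhedron H g).extremePoints ℝ, x ∈ faceOf H g σ → l x < c)
    (hgt : ∀ x ∈ (polyhedron H g).extremePoints ℝ, x ∉ faceOf H g σ → c < l x) (τ : Set A) :
    τ ∈ activeSets H (addIneq g s l c) ↔
      τ \ {s} ∈ activeSets H g ∧ ¬ σ ⊆ τ \ {s} ∧
        (s ∈ τ → ∃ ρ ∈ activeSets H g, σ ∪ τ \ {s} ⊆ ρ) := by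
  have hsn : ∀ x, s ∉ active g x := fun x h => by
    have : g s x = 0 := h
    rw [hs] at this
    exact one_ne_zero this
  have hσlt : ∀ x ∈ faceOf H g σ, l x < c := by
    intro x hx
    obtain ⟨v, hv, hvF, hle⟩ := exists_extremePoint_ge hQ hx l.toAffineMap
    exact lt_of_le_of_lt hle (hlt v hv hvF)
  constructor
  · rintro ⟨x, hx, rfl⟩
    rw [polyhedron_addIneq hs] at hx
    have hnσ : ¬ σ ⊆ active g x := fun h => (hσlt x ⟨hx.1, h⟩).not_ge hx.2
    by_cases hlx : l x = c
    · rw [active_addIneq_of_eq hlx, insert_sdiff_of_mem _ (mem_singleton s),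
        sdiff_singleton_eq_self (hsn x)]
      refine ⟨⟨x, hx.1, rfl⟩, hnσ, fun _ => ?_⟩
      -- A vertex minimizing `l` on the face of `x` has `l v ≤ c`, so it belongs to the truncated
      -- face; its active set is the required `ρ`.
      obtain ⟨v, hv, hvF, hle⟩ := exists_extremePoint_ge hQ
        (⟨hx.1, Subset.rfl⟩ : x ∈ faceOf H g (active g x)) (-l).toAffineMap
      have hle' : l v ≤ c := by
        have : -l x ≤ -l v := hle
        linarith
      have hvσ : v ∈ faceOf H g σ := by
        by_contra h
        exact (hgt v hv h).not_ge hle'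
      exact ⟨active g v, ⟨v, hvF.1, rfl⟩, union_subset hvσ.2 hvF.2⟩
    · rw [active_addIneq_of_ne hs hlx, sdiff_singleton_eq_self (hsn x)]
      exact ⟨⟨x, hx.1, rfl⟩, hnσ, fun h => absurd h (hsn x)⟩
  · rintro ⟨⟨y, hy, hyτ⟩, hσ, hρ⟩
    rw [← hyτ] at hσ hρ
    -- a point with the same active set beyond the hyperplane
    obtain ⟨a, haσ, ha⟩ := not_subset.1 hσ
    obtain ⟨v, hv, hvF, hle⟩ := exists_extremePoint_ge hQ
      (⟨hy, Subset.rfl⟩ : y ∈ faceOf H g (active g y)) (g a)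
    have hpos : 0 < g a v := lt_of_lt_of_le (lt_of_le_of_ne (hy.2 a) (Ne.symm ha)) hle
    have hvl : c < l v := hgt v hv fun h => hpos.ne' (h.2 haσ)
    -- Points of the open segment from `u` to `y` have exactly the active set of `y`, and those near
    -- `u` have values of `l` near `l u`.
    have near : ∀ u ∈ polyhedron H g, active g y ⊆ active g u → ∀ U : Set ℝ, IsOpen U → l u ∈ U →
        ∃ z ∈ polyhedron H g, active g z = active g y ∧ l z ∈ U := by
      intro u hu hsub U hU hlu
      have hc : Continuous fun r : ℝ => l (AffineMap.lineMap u y r) := by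
        have := fun r => apply_lineMap_real l.toAffineMap u y r
        simp only [LinearMap.coe_toAffineMap] at this
        simp only [this]
        fun_prop
      have h1 := hc.tendsto 0
      simp only [AffineMap.lineMap_apply_zero] at h1
      have h2 := h1.eventually (hU.mem_nhds hlu)
      have h3 : ∀ᶠ r in 𝓝 (0 : ℝ), r < 1 := gt_mem_nhds one_pos
      obtain ⟨r, ⟨h4, h5⟩, h6⟩ := ((h2.and h3).filter_mono nhdsWithin_le_nhds |>.and
        (self_mem_nhdsWithin (s := Ioi (0 : ℝ)))).exists
      have h6' : 0 < r := h6
      refine ⟨_, lineMap_mem_polyhedron hu hy h6'.le h5.le, ?_, h4⟩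
      rw [active_lineMap hu hy h6' h5, inter_eq_right.2 hsub]
    obtain ⟨z, hz, hzy, hzl⟩ := near v hvF.1 hvF.2 (Ioi c) isOpen_Ioi hvl
    have hzl' : c < l z := hzl
    by_cases hsτ : s ∈ τ
    · obtain ⟨ρ, ⟨u, hu, rfl⟩, hρ⟩ := hρ hsτ
      obtain ⟨w, hw, hwy, hwl⟩ := near u hu (subset_union_right.trans hρ) (Iio c) isOpen_Iio
        (hσlt u ⟨hu, subset_union_left.trans hρ⟩)
      have hwl' : l w < c := hwl
      have hd : 0 < l z - l w := by linarith
      -- The segment from `w`, below the hyperplane, to `z`, above it, crosses the hyperplane at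
      -- this parameter, and its interior keeps the active set of `y`.
      set r : ℝ := (c - l w) / (l z - l w) with hr
      have h0 : 0 < r := div_pos (by linarith) hd
      have h1 : r < 1 := (div_lt_one hd).2 (by linarith)
      have hlc : l (AffineMap.lineMap w z r) = c := by
        have := apply_lineMap_real l.toAffineMap w z r
        simp only [LinearMap.coe_toAffineMap] at this
        rw [this, hr]
        field_simp
        ring
      refine ⟨AffineMap.lineMap w z r, ?_, ?_⟩
      · rw [polyhedron_addIneq hs]
        exact ⟨lineMap_mem_polyhedron hw hz h0.le h1.le, hlc.ge⟩
      · rw [active_addIneq_of_eq hlc, active_lineMap hw hz h0 h1, hwy, hzy, inter_self, hyτ,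
          insert_sdiff_singleton, insert_eq_of_mem hsτ]
    · refine ⟨z, ?_, ?_⟩
      · rw [polyhedron_addIneq hs]
        exact ⟨hz, hzl'.le⟩
      · rw [active_addIneq_of_ne hs hzl'.ne', hzy, hyτ, sdiff_singleton_eq_self hsτ]

end Polyhedron

end GraphAssoc

/-! ### The faces of graph associahedra -/

namespace GraphAssoc

open Set Filter Topology

variable {ι : Type*} {G : SimpleGraph ι}

/-- The active sets after truncating the simplex at the tubes in `𝓛`: the label `inl i` stands for
the facet `x_i = 0` of the simplex, and `inr t` for the facet cut off at the tube `t`. -/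
def Nested (𝓛 : Set (Set ι)) (τ : Set (ι ⊕ Set ι)) : Prop :=
  (∀ t, .inr t ∈ τ → t ∈ 𝓛) ∧ ∀ t, t ∈ 𝓛 ∨ t = univ →
    ¬ t ⊆ {i | .inl i ∈ τ ∨ ∃ u, .inr u ∈ τ ∧ u ⊂ t ∧ i ∈ u}

/-- The effect on nested sets of truncating at a tube `s` no larger than the previous ones. -/
lemma nested_insert_iff [Finite ι] {𝓛 : Set (Set ι)} {s : Set ι} (hs : IsTube G s) (hs𝓛 : s ∉ 𝓛)
    (h𝓛 : ∀ t ∈ 𝓛, IsTube G t) (hle : ∀ t ∈ 𝓛, s.ncard ≤ t.ncard)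
    (hgt : ∀ t, IsTube G t → s.ncard < t.ncard → t ∈ 𝓛) (hG : G.Connected)
    (τ : Set (ι ⊕ Set ι)) :
    Nested (insert s 𝓛) τ ↔ Nested 𝓛 (τ \ {.inr s}) ∧ ¬ Sum.inl '' s ⊆ τ \ {.inr s} ∧
      (.inr s ∈ τ → ∃ ρ, Nested 𝓛 ρ ∧ Sum.inl '' s ∪ τ \ {.inr s} ⊆ ρ) := by
  have hmem : ∀ t, t ∈ 𝓛 ∨ t = univ → (G.induce t).Connected ∧ s.ncard ≤ t.ncard := by
    rintro t (ht | rfl)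
    · exact ⟨(h𝓛 t ht).2.2, hle t ht⟩
    · exact ⟨(SimpleGraph.induceUnivIso G).connected_iff.2 hG,
        Set.ncard_le_ncard (subset_univ _) (Set.toFinite _)⟩
  have hsne : ∀ t, t ∈ 𝓛 ∨ t = univ → t ≠ s := by
    rintro t (ht | rfl) rfl
    · exact hs𝓛 ht
    · exact hs.2.1 rfl
  have hsmall : ∀ u ∈ 𝓛, ¬ u ⊂ s := fun u hu hus =>
    (Set.ncard_lt_ncard hus (Set.toFinite _)).not_ge (hle u hu)
  constructor
  · intro h
    refine ⟨⟨fun t ht => ?_, fun t ht hsub => ?_⟩, fun hsub => ?_, fun hsτ => ?_⟩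
    · exact (h.1 t ht.1).resolve_left fun hts => ht.2 (by rw [hts]; rfl)
    · refine h.2 t (ht.imp_left (mem_insert_of_mem _)) (hsub.trans ?_)
      rintro i (hi | ⟨u, hu, hut, hi⟩)
      · exact .inl hi.1
      · exact .inr ⟨u, hu.1, hut, hi⟩
    · refine h.2 s (.inl (mem_insert _ _)) fun i hi => .inl ?_
      exact (hsub ⟨i, hi, rfl⟩).1
    · refine ⟨_, ⟨?_, ?_⟩, Subset.rfl⟩
      · rintro t (⟨_, _, h⟩ | ht)
        · cases h
        · exact (h.1 t ht.1).resolve_left fun hts => ht.2 (by rw [hts]; rfl)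
      · intro t ht hsub
        have ht' : ∀ i ∈ t, i ∈ s ∨ .inl i ∈ τ ∨ ∃ u, .inr u ∈ τ ∧ u ⊂ t ∧ i ∈ u := by
          intro i hi
          rcases hsub hi with (⟨j, hj, hji⟩ | hi') | ⟨u, ⟨_, _, hu⟩ | hu, hut, hi'⟩
          · cases hji; exact .inl hj
          · exact .inr (.inl hi'.1)
          · cases hu
          · exact .inr (.inr ⟨u, hu.1, hut, hi'⟩)
        -- The nodes of `s` are now free to use in the cover of `t`. If `s ⊂ t`, the tube `s` covers
        -- them instead. If `s` only overlaps `t`, the tube `s` helps to cover `t ∪ s`, which is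
        -- connected and larger than `s`, hence already in `𝓛` or everything.
        by_cases hst : s ⊆ t
        · have hst' : s ⊂ t := hst.ssubset_of_ne (hsne t ht).symm
          refine h.2 t (ht.imp_left (mem_insert_of_mem _)) fun i hi => ?_
          rcases ht' i hi with h' | h'
          · exact .inr ⟨s, hsτ, hst', h'⟩
          · exact h'
        · by_cases hne : (t ∩ s).Nonempty
          · have hts : ¬ t ⊆ s := fun hts => (hmem t ht).2.not_gt
              (Set.ncard_lt_ncard (hts.ssubset_of_ne (hsne t ht)) (Set.toFinite _))
            have hss : s ⊂ t ∪ s := subset_union_right.ssubset_of_not_subset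
              fun h' => hts (subset_union_left.trans h')
            have htt : t ⊆ t ∪ s := subset_union_left
            have hconn : (G.induce (t ∪ s)).Connected :=
              connected_union_of_inter (hmem t ht).1 hs.2.2 hne
            have hin : t ∪ s ∈ insert s 𝓛 ∨ t ∪ s = univ := by
              by_cases hu : t ∪ s = univ
              · exact .inr hu
              · refine .inl (mem_insert_of_mem _
                  (hgt _ ⟨nonempty_of_connected hconn, hu, hconn⟩ ?_))
                exact Set.ncard_lt_ncard hss (Set.toFinite _)
            refine h.2 _ hin ?_
            rintro i (hi | hi)
            · rcases ht' i hi with h' | h' | ⟨u, hu, hut, hi'⟩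
              · exact .inr ⟨s, hsτ, hss, h'⟩
              · exact .inl h'
              · exact .inr ⟨u, hu, hut.trans_subset htt, hi'⟩
            · exact .inr ⟨s, hsτ, hss, hi⟩
          · refine h.2 t (ht.imp_left (mem_insert_of_mem _)) fun i hi => ?_
            exact (ht' i hi).resolve_left fun h' => hne ⟨i, hi, h'⟩
  · rintro ⟨h1, h2, h3⟩
    refine ⟨fun t ht => ?_, ?_⟩
    · by_cases hts : t = s
      · exact .inl hts
      · exact .inr (h1.1 t ⟨ht, fun h => hts (Sum.inr_injective h)⟩)
    -- In a cover that uses the tube `s`, the nodes of `s` in `ρ` can replace it.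
    · have old : ∀ t, t ∈ 𝓛 ∨ t = univ →
          ¬ t ⊆ {i | .inl i ∈ τ ∨ ∃ u, .inr u ∈ τ ∧ u ⊂ t ∧ i ∈ u} := by
        intro t ht hsub
        by_cases hsτ : .inr s ∈ τ
        · obtain ⟨ρ, hρ, hρs⟩ := h3 hsτ
          refine hρ.2 t ht (hsub.trans ?_)
          rintro i (hi | ⟨u, hu, hut, hi⟩)
          · exact .inl (hρs (.inr ⟨hi, fun h => by cases h⟩))
          · by_cases hus : u = s
            · exact .inl (hρs (.inl ⟨i, hus ▸ hi, rfl⟩))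
            · exact .inr ⟨u, hρs (.inr ⟨hu, fun h => hus (Sum.inr_injective h)⟩), hut, hi⟩
        · rw [sdiff_singleton_eq_self hsτ] at h1
          exact h1.2 t ht hsub
      rintro t ((rfl | ht) | ht)
      · intro hsub
        refine h2 ?_
        rintro _ ⟨i, hi, rfl⟩
        refine ⟨?_, fun h => by cases h⟩
        -- No earlier tube is properly contained in `s`, so `s` can only be covered by single nodes.
        rcases hsub hi with h | ⟨u, hu, hut, -⟩
        · exact h
        · exact absurd hut (hsmall u (h1.1 u ⟨hu, fun h => hut.ne (Sum.inr_injective h)⟩))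
      · exact old t (.inl ht)
      · exact old t (.inr ht)

/-- The nested sets for all the tubes are the tubings. -/
lemma nested_isTube_iff (hG : G.Connected) [Finite ι] (τ : Set (ι ⊕ Set ι)) :
    Nested {t | IsTube G t} τ ↔ (∀ i, .inl i ∉ τ) ∧ (∀ t, .inr t ∈ τ → IsTube G t) ∧
      {t | .inr t ∈ τ}.Pairwise (Compat G) := by
  constructor
  · intro h
    refine ⟨fun i hi => ?_, h.1, fun t ht u hu htu => ?_⟩
    -- A single node is a tube or the whole graph, and as such must not be covered.
    · refine h.2 {i} ?_ fun j hj => .inl (by rw [hj]; exact hi)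
      by_cases hu : ({i} : Set ι) = univ
      · exact .inr hu
      · exact .inl ⟨singleton_nonempty i, hu, connected_singleton i⟩
    -- Two incompatible tubes would cover their connected union by properly smaller tubes.
    · have key : (G.induce (t ∪ u)).Connected → ¬ t ⊆ u → ¬ u ⊆ t → False := by
        intro hconn htu hut
        refine h.2 (t ∪ u) ?_ ?_
        · by_cases huniv : t ∪ u = univ
          · exact .inr huniv
          · exact .inl ⟨nonempty_of_connected hconn, huniv, hconn⟩
        · rintro i (hi | hi)
          · exact .inr ⟨t, ht, subset_union_left.ssubset_of_not_subset
              fun h' => hut (subset_union_right.trans h'), hi⟩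
          · exact .inr ⟨u, hu, subset_union_right.ssubset_of_not_subset
              fun h' => htu (subset_union_left.trans h'), hi⟩
      refine ⟨fun hi => key ?_ hi.2.1 hi.2.2, fun ha => key ha.2 ?_ ?_⟩
      · exact connected_union_of_inter (h.1 t ht).2.2 (h.1 u hu).2.2 hi.1
      · intro hsub
        exact (h.1 t ht).1.ne_empty (by rw [← ha.1, inter_eq_left.2 hsub])
      · intro hsub
        exact (h.1 u hu).1.ne_empty (by rw [← ha.1, inter_eq_right.2 hsub])
  · rintro ⟨h1, h2, h3⟩
    refine ⟨h2, fun t ht hsub => ?_⟩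
    have htconn : (G.induce t).Connected := by
      rcases ht with ht | rfl
      · exact ht.2.2
      · exact (SimpleGraph.induceUnivIso G).connected_iff.2 hG
    have hcov : ∀ i ∈ t, ∃ u, .inr u ∈ τ ∧ u ⊂ t ∧ i ∈ u := fun i hi =>
      (hsub hi).resolve_left (h1 i)
    obtain ⟨i, hi⟩ := nonempty_of_connected htconn
    obtain ⟨u, hu, hut, -⟩ := hcov i hi
    -- An edge of `t` that leaves a maximal covering tube `m` ends in another covering tube `v`;
    -- then `m` and `v` are neither nested, by maximality, nor separated.
    obtain ⟨m, hm⟩ := (Set.toFinite {u | .inr u ∈ τ ∧ u ⊂ t}).exists_maximal ⟨u, hu, hut⟩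
    obtain ⟨hmτ, hmt⟩ := hm.prop
    obtain ⟨a, ha, b, hb, hab⟩ := exists_adj_of_connected_of_not_subset (t := m) htconn
      (by rw [inter_eq_right.2 hmt.1]; exact (h2 m hmτ).1) hmt.2
    obtain ⟨v, hv, hvt, hbv⟩ := hcov b hb.1
    have hne : m ≠ v := fun h => hb.2 (h ▸ hbv)
    rcases (h3 hmτ hv hne).trichotomy (h2 m hmτ).2.2 (h2 v hv).2.2 with h | h | h
    · exact hne (h.antisymm (hm.le_of_ge ⟨hv, hvt⟩ h))
    · exact hb.2 (h hbv)
    · exact h.2 a ha.1 b hbv hab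

/-! ### Realizing nested sets by truncations of the simplex -/

section Model

variable [Fintype ι]

/-- The hyperplane `∑ x_i = 1`. -/
def simplexHyperplane (ι : Type*) [Fintype ι] : AffineSubspace ℝ (ι → ℝ) where
  carrier := {x | ∑ i, x i = 1}
  smul_vsub_vadd_mem' c x y z hx hy hz := by
    change ∑ i, (c • (x -ᵥ y) +ᵥ z) i = 1
    have hx' : ∑ i, x i = 1 := hx
    have hy' : ∑ i, y i = 1 := hy
    have hz' : ∑ i, z i = 1 := hz
    simp [Finset.sum_add_distrib, ← Finset.mul_sum, Finset.sum_sub_distrib, hx', hy', hz']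

/-- `Q` is a truncation of the standard simplex, with one additional inequality for each tube in
`𝓛`, whose active sets are the nested sets of `𝓛`. -/
def IsModel (𝓛 : Set (Set ι)) (Q : Set (ι → ℝ)) : Prop :=
  ∃ g : ι ⊕ Set ι → (ι → ℝ) →ᵃ[ℝ] ℝ, (∀ i x, g (.inl i) x = x i) ∧
    (∀ t ∉ 𝓛, ∀ x, g (.inr t) x = 1) ∧ Q = polyhedron (simplexHyperplane ι) g ∧
    ∀ τ, τ ∈ activeSets (simplexHyperplane ι) g ↔ Nested 𝓛 τ

lemma isCompact_polyhedron_of_coord {g : ι ⊕ Set ι → (ι → ℝ) →ᵃ[ℝ] ℝ}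
    (hg : ∀ i x, g (.inl i) x = x i) : IsCompact (polyhedron (simplexHyperplane ι) g) := by
  refine (isCompact_univ_pi fun _ : ι => isCompact_Icc (a := (0 : ℝ)) (b := 1)).of_isClosed_subset
    isClosed_polyhedron ?_
  intro x hx i _
  have h0 : ∀ i, 0 ≤ x i := fun i => by rw [← hg i x]; exact hx.2 _
  refine ⟨h0 i, ?_⟩
  have h1 : ∑ i, x i = 1 := hx.1
  rw [← h1]
  exact Finset.single_le_sum (fun j _ => h0 j) (Finset.mem_univ i)

lemma faceOf_image_inl {g : ι ⊕ Set ι → (ι → ℝ) →ᵃ[ℝ] ℝ} (hg : ∀ i x, g (.inl i) x = x i)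
    (s : Set ι) : faceOf (simplexHyperplane ι) g (Sum.inl '' s) =
      {x ∈ polyhedron (simplexHyperplane ι) g | ∀ i ∈ s, x i = 0} := by
  ext x
  refine and_congr_right fun _ => ?_
  rw [image_subset_iff]
  exact forall₂_congr fun i _ => by rw [← hg i x]; rfl

lemma isModel_simplex [Nonempty ι] :
    IsModel ∅ {x : ι → ℝ | (∀ i, 0 ≤ x i) ∧ ∑ᶠ i, x i = 1} := by
  let g : ι ⊕ Set ι → (ι → ℝ) →ᵃ[ℝ] ℝ :=
    Sum.elim (fun i => (LinearMap.proj i).toAffineMap) fun _ => AffineMap.const ℝ _ 1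
  have hg : ∀ i x, g (.inl i) x = x i := fun i x => rfl
  have hg' : ∀ t x, g (.inr t) x = 1 := fun t x => rfl
  refine ⟨g, hg, fun t _ => hg' t, ?_, fun τ => ?_⟩
  · ext x
    rw [mem_ofPred_eq, finsum_eq_sum_of_fintype]
    constructor
    · rintro ⟨h1, h2⟩
      refine ⟨h2, ?_⟩
      rintro (i | t)
      · exact h1 i
      · exact zero_le_one
    · rintro ⟨h1, h2⟩
      exact ⟨fun i => h2 (.inl i), h1⟩
  · constructor
    · rintro ⟨x, hx, rfl⟩
      refine ⟨fun t (ht : g (.inr t) x = 0) => absurd ht one_ne_zero, ?_⟩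
      rintro t (ht | rfl) hsub
      · exact ht.elim
      · have h0 : ∀ i, x i = 0 := fun i => by
          rcases hsub (mem_univ i) with h | ⟨u, hu, -⟩
          · exact h
          · exact absurd (show g (.inr u) x = 0 from hu) one_ne_zero
        have h1 : ∑ i, x i = 1 := hx.1
        rw [Finset.sum_eq_zero fun i _ => h0 i] at h1
        exact zero_ne_one h1
    · intro h
      classical
      obtain ⟨i₀, hi₀⟩ : ∃ i, .inl i ∉ τ := by
        by_contra! hcon
        exact h.2 univ (.inr rfl) fun i _ => .inl (hcon i)
      -- The barycentre of the face opposite to the nodes in `τ` has active set `τ`.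
      set s : Finset ι := Finset.univ.filter fun i => .inl i ∉ τ
      have hs : ∀ i, i ∈ s ↔ .inl i ∉ τ := fun i => by simp [s]
      have hpos : 0 < (s.card : ℝ) := by
        exact_mod_cast Finset.card_pos.2 ⟨i₀, (hs i₀).2 hi₀⟩
      refine ⟨fun i => if i ∈ s then (s.card : ℝ)⁻¹ else 0, ⟨?_, ?_⟩, ?_⟩
      · change ∑ i, _ = (1 : ℝ)
        rw [Finset.sum_ite_mem, Finset.univ_inter, Finset.sum_const, nsmul_eq_mul,
          mul_inv_cancel₀ hpos.ne']
      · rintro (i | t)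
        · rw [hg]; positivity
        · rw [hg']; exact zero_le_one
      · ext a
        rcases a with i | t
        · simp only [active, mem_ofPred_eq, hg]
          by_cases hi : i ∈ s
          · simpa [hi, hpos.ne'] using (hs i).1 hi
          · simpa [hi] using fun h => hi ((hs i).2 h)
        · simp only [active, mem_ofPred_eq, hg', one_ne_zero, false_iff]
          exact fun ht => h.1 t ht

/-- The geometric rule `mem_activeSets_addIneq` and the combinatorial rule `nested_insert_iff` have
the same shape, so active sets and nested sets evolve together. -/
lemma IsModel.truncation {𝓛 : Set (Set ι)} {Q Q' : Set (ι → ℝ)} (h : IsModel 𝓛 Q) {s : Set ι}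
    (hs : IsTube G s) (hs𝓛 : s ∉ 𝓛) (h𝓛 : ∀ t ∈ 𝓛, IsTube G t)
    (hle : ∀ t ∈ 𝓛, s.ncard ≤ t.ncard) (hgt : ∀ t, IsTube G t → s.ncard < t.ncard → t ∈ 𝓛)
    (hG : G.Connected) (hQ' : IsTruncation Q {x ∈ Q | ∀ i ∈ s, x i = 0} Q') :
    IsModel (insert s 𝓛) Q' := by
  obtain ⟨g, hg, hg', rfl, hact⟩ := h
  obtain ⟨l, c, hlt, hct, rfl⟩ := hQ'
  rw [← faceOf_image_inl hg] at hlt hct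
  have hs1 := hg' s hs𝓛
  refine ⟨addIneq g (.inr s) l c, fun i x => ?_, fun t ht x => ?_, ?_, fun τ => ?_⟩
  · rw [addIneq_of_ne (by simp), hg]
  · rw [addIneq_of_ne (fun h => ht (.inl (Sum.inr_injective h))),
      hg' t fun h => ht (.inr h)]
  · rw [polyhedron_addIneq hs1]
  · rw [mem_activeSets_addIneq (isCompact_polyhedron_of_coord hg) hs1 hlt hct,
      nested_insert_iff hs hs𝓛 h𝓛 hle hgt hG, hact]
    simp only [hact]

/-- The sum of the coordinates in `s` vanishes on the face and is positive at each of the finitely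
many other vertices, so any small positive `c` separates. -/
lemma IsModel.exists_truncation {𝓛 : Set (Set ι)} {Q : Set (ι → ℝ)} (h : IsModel 𝓛 Q)
    (s : Set ι) : ∃ Q', IsTruncation Q {x ∈ Q | ∀ i ∈ s, x i = 0} Q' := by
  classical
  obtain ⟨g, hg, -, rfl, -⟩ := h
  set Q := polyhedron (simplexHyperplane ι) g
  have h0 : ∀ x ∈ Q, ∀ i, 0 ≤ x i := fun x hx i => by rw [← hg i x]; exact hx.2 _
  let l : (ι → ℝ) →ₗ[ℝ] ℝ := ∑ i ∈ s.toFinset, LinearMap.proj i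
  have hl : ∀ x, l x = ∑ i ∈ s.toFinset, x i := fun x => by simp [l]
  have hl0 : ∀ x ∈ Q, 0 ≤ l x := fun x hx => by
    rw [hl]; exact Finset.sum_nonneg fun i _ => h0 x hx i
  have hfin : (Q.extremePoints ℝ).Finite := finite_extremePoints
  have hpos : ∀ x ∈ Q, x ∉ {x ∈ Q | ∀ i ∈ s, x i = 0} → 0 < l x := by
    intro x hx hxF
    refine lt_of_le_of_ne (hl0 x hx) fun h => hxF ⟨hx, fun i hi => ?_⟩
    rw [hl] at h
    exact (Finset.sum_eq_zero_iff_of_nonneg fun i _ => h0 x hx i).1 h.symm i (by simpa using hi)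
  obtain ⟨c, hc0, hc⟩ : ∃ c : ℝ, 0 < c ∧ ∀ x ∈ Q.extremePoints ℝ,
      x ∉ {x ∈ Q | ∀ i ∈ s, x i = 0} → c < l x := by
    have hev : ∀ᶠ c in 𝓝[>] (0 : ℝ), ∀ x ∈ Q.extremePoints ℝ,
        x ∉ {x ∈ Q | ∀ i ∈ s, x i = 0} → c < l x := by
      rw [hfin.eventually_all]
      intro x hx
      by_cases hxF : x ∈ {x ∈ Q | ∀ i ∈ s, x i = 0}
      · exact Eventually.of_forall fun c h => absurd hxF h
      · have h := gt_mem_nhds (hpos x (extremePoints_subset hx) hxF)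
        exact (Eventually.filter_mono nhdsWithin_le_nhds h).mono fun c hc _ => hc
    obtain ⟨c, hc, hc0⟩ := (hev.and self_mem_nhdsWithin).exists
    exact ⟨c, hc0, hc⟩
  refine ⟨_, l, c, fun x _ hxF => ?_, hc, rfl⟩
  rw [hl, Finset.sum_eq_zero fun i hi => hxF.2 i (by simpa using hi)]
  exact hc0

/-- Truncating successively at the remaining tubes is possible, and leads from nested sets to
tubings. -/
lemma IsModel.iteratedTruncation (hG : G.Connected) (L : List (Set ι)) :
    ∀ (𝓛 : Set (Set ι)) (Q : Set (ι → ℝ)), IsModel 𝓛 Q →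
      (∀ t, IsTube G t ↔ t ∈ 𝓛 ∨ t ∈ L) → L.Nodup → (∀ t ∈ L, t ∉ 𝓛) →
      L.Pairwise (fun t u => u.ncard ≤ t.ncard) → (∀ t ∈ 𝓛, ∀ u ∈ L, u.ncard ≤ t.ncard) →
      (∃ P, IsIteratedTruncation Q L P) ∧
        ∀ P, IsIteratedTruncation Q L P → IsModel {t | IsTube G t} P := by
  induction L with
  | nil =>
    intro 𝓛 Q hQ htube _ _ _ _
    refine ⟨⟨Q, .nil Q⟩, fun P hP => ?_⟩
    cases hP
    have : {t | IsTube G t} = 𝓛 := by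
      ext t; simp [htube]
    rwa [this]
  | cons s L ih =>
    intro 𝓛 Q hQ htube hnd hdisj hpw hle
    rw [List.nodup_cons] at hnd
    rw [List.pairwise_cons] at hpw
    have step : ∀ Q', IsTruncation Q {x ∈ Q | ∀ i ∈ s, x i = 0} Q' →
        (∃ P, IsIteratedTruncation Q' L P) ∧
          ∀ P, IsIteratedTruncation Q' L P → IsModel {t | IsTube G t} P := by
      intro Q' h
      refine ih (insert s 𝓛) Q' (hQ.truncation ((htube s).2 (.inr List.mem_cons_self))
        (hdisj s List.mem_cons_self) (fun t ht => (htube t).2 (.inl ht))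
        (fun t ht => hle t ht s List.mem_cons_self) ?_ hG h) ?_ hnd.2 ?_ hpw.2 ?_
      -- By the order of the list, a tube larger than `s` can no longer be waiting.
      · intro t ht hst
        rcases (htube t).1 ht with h | h
        · exact h
        · rcases List.mem_cons.1 h with rfl | h
          · exact absurd hst (lt_irrefl _)
          · exact absurd hst (hpw.1 t h).not_gt
      · intro t
        rw [htube, List.mem_cons, mem_insert_iff]
        tauto
      · rintro t ht (rfl | h)
        · exact hnd.1 ht
        · exact hdisj t (List.mem_cons_of_mem _ ht) h
      · rintro t (rfl | ht) u hu
        · exact hpw.1 u hu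
        · exact hle t ht u (List.mem_cons_of_mem _ hu)
    constructor
    · obtain ⟨Q', h⟩ := hQ.exists_truncation s
      obtain ⟨P, hP⟩ := (step Q' h).1
      exact ⟨P, .cons Q Q' P s L h hP⟩
    · intro P hP
      cases hP with
      | cons _ Q' _ _ _ h h' => exact (step Q' h).2 P h'

end Model

/-- Graph associahedra of connected graphs exist. -/
theorem exists_isGraphAssociahedron [Finite ι] (hG : G.Connected) :
    ∃ P, IsGraphAssociahedron G P := by
  classical
  have := Fintype.ofFinite ι
  have := hG.nonempty
  let L₀ : List (Set ι) := (Set.toFinite {t | IsTube G t}).toFinset.toList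
  let L := L₀.mergeSort (fun t u => decide (u.ncard ≤ t.ncard))
  have hperm : L.Perm L₀ := List.mergeSort_perm _ _
  have hnd : L.Nodup := hperm.nodup_iff.2 (Finset.nodup_toList _)
  have hmem : ∀ t, t ∈ L ↔ IsTube G t := fun t => by
    rw [hperm.mem_iff]; simp [L₀]
  have hpw : L.Pairwise (fun t u => u.ncard ≤ t.ncard) := by
    have := List.pairwise_mergeSort (le := fun t u : Set ι => decide (u.ncard ≤ t.ncard))
      (fun a b c => by simpa using fun h1 h2 => le_trans h2 h1)
      (fun a b => by simpa using le_total _ _) L₀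
    simpa using this
  obtain ⟨P, hP⟩ := (isModel_simplex.iteratedTruncation hG L _ _ (by simp [hmem]) hnd (by simp)
    hpw (by simp)).1
  exact ⟨P, L, hnd, hmem, hpw, hP⟩

/-- The face poset of a graph associahedron is dual to the poset of tubings. -/
theorem IsGraphAssociahedron.nonempty_orderIso [Finite ι] (hG : G.Connected) {P : Set (ι → ℝ)}
    (hP : IsGraphAssociahedron G P) : Nonempty (Tubing G ≃o (Face P)ᵒᵈ) := by
  have := Fintype.ofFinite ι
  have := hG.nonempty
  obtain ⟨L, hnd, hmem, hpw, hP⟩ := hP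
  obtain ⟨g, -, -, rfl, hact⟩ := (isModel_simplex.iteratedTruncation hG L _ _ (by simp [hmem])
    hnd (by simp) hpw (by simp)).2 P hP
  obtain ⟨e⟩ := nonempty_orderIso_face (H := simplexHyperplane ι) (g := g)
  have hmem' : ∀ τ, τ ∈ activeSets (simplexHyperplane ι) g ↔ _ := fun τ =>
    (hact τ).trans (nested_isTube_iff hG τ)
  let f : Tubing G ≃o activeSets (simplexHyperplane ι) g :=
    { toFun := fun T => ⟨Sum.inr '' T.1, (hmem' _).2 ⟨by simp, by simpa using T.2.1, by
        have : {t | Sum.inr t ∈ (Sum.inr '' T.1 : Set (ι ⊕ Set ι))} = T.1 := by ext t; simp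
        rw [this]; exact T.2.2⟩⟩
      invFun := fun τ => ⟨{t : Set ι | Sum.inr t ∈ τ.1},
        ((hmem' _).1 τ.2).2.1, ((hmem' _).1 τ.2).2.2⟩
      left_inv := fun T => by apply Subtype.ext; ext t; simp
      right_inv := fun τ => by
        apply Subtype.ext
        ext (i | t)
        · simpa using ((hmem' _).1 τ.2).1 i
        · simp
      map_rel_iff' := fun {T T'} => image_subset_image_iff Sum.inr_injective }
  exact ⟨f.trans e⟩

/-! ### Faces of products -/

section Product

variable {κ : Type*} [Finite κ] {E : κ → Type*} [∀ k, AddCommGroup (E k)] [∀ k, Module ℝ (E k)]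
  [∀ k, TopologicalSpace (E k)]

/-- The sum of functionals exposing the factors works: a sum of maxima is attained only if each term
is maximal. -/
lemma isExposed_univ_pi {P F : ∀ k, Set (E k)} (hne : ∀ k, (F k).Nonempty)
    (hF : ∀ k, IsExposed ℝ (P k) (F k)) : IsExposed ℝ (univ.pi P) (univ.pi F) := by
  have := Fintype.ofFinite κ
  intro _
  choose l hl using fun k => hF k (hne k)
  refine ⟨∑ k, (l k).comp (ContinuousLinearMap.proj k), ?_⟩
  have hsum : ∀ x, (∑ k, (l k).comp (ContinuousLinearMap.proj k) : StrongDual ℝ (∀ k, E k)) x =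
      ∑ k, l k (x k) := fun x => by simp
  choose m hm using hne
  have hm' : ∀ k, m k ∈ P k ∧ ∀ y ∈ P k, l k y ≤ l k (m k) := fun k => by
    have := hm k; rw [hl k] at this; exact this
  ext x
  simp only [mem_univ_pi, mem_ofPred_eq, hsum]
  constructor
  · intro hx
    have hx' : ∀ k, x k ∈ P k ∧ ∀ y ∈ P k, l k y ≤ l k (x k) := fun k => by
      have := hx k; rw [hl k] at this; exact this
    exact ⟨fun k => (hx' k).1, fun y hy => Finset.sum_le_sum fun k _ => (hx' k).2 _ (hy k)⟩
  · rintro ⟨hx, hmax⟩ k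
    have hle : ∀ k, l k (x k) ≤ l k (m k) := fun k => (hm' k).2 _ (hx k)
    have heq := (Finset.sum_eq_sum_iff_of_le fun k _ => hle k).1
      (le_antisymm (Finset.sum_le_sum fun k _ => hle k) (hmax m fun k => (hm' k).1)) k
      (Finset.mem_univ k)
    rw [hl k]
    exact ⟨hx k, fun y hy => heq ▸ (hm' k).2 y hy⟩

/-- A functional on a finite product is the sum of its restrictions to the factors, which can be
maximized independently. -/
lemma exists_univ_pi_eq_of_isExposed {P : ∀ k, Set (E k)} {F : Set (∀ k, E k)} (hne : F.Nonempty)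
    (hF : IsExposed ℝ (univ.pi P) F) :
    ∃ F' : ∀ k, Set (E k), (∀ k, (F' k).Nonempty) ∧ (∀ k, IsExposed ℝ (P k) (F' k)) ∧
      F = univ.pi F' := by
  classical
  have := Fintype.ofFinite κ
  obtain ⟨l, rfl⟩ := hF hne
  obtain ⟨x₀, hx₀, hmax⟩ := hne
  rw [mem_univ_pi] at hx₀
  let l' : ∀ k, StrongDual ℝ (E k) := fun k => l.comp (ContinuousLinearMap.single ℝ E k)
  have hl : ∀ x, l x = ∑ k, l' k (x k) := by
    intro x
    conv_lhs => rw [← Finset.univ_sum_single x]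
    simp [l']
  have hx₀' : ∀ k, ∀ y ∈ P k, l' k y ≤ l' k (x₀ k) := by
    intro k y hy
    have h1 := hmax (Function.update x₀ k y) (by
      rw [mem_univ_pi]
      intro j
      by_cases hj : j = k
      · subst hj; simpa using hy
      · simpa [hj] using hx₀ j)
    rw [hl, hl, ← Finset.add_sum_erase _ _ (Finset.mem_univ k),
      ← Finset.add_sum_erase _ _ (Finset.mem_univ k), Function.update_self,
      Finset.sum_congr rfl fun j hj => by
        rw [Function.update_of_ne (Finset.ne_of_mem_erase hj)]] at h1
    linarith
  refine ⟨fun k => (l' k).toExposed (P k), fun k => ⟨x₀ k, hx₀ k, hx₀' k⟩,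
    fun k => ContinuousLinearMap.toExposed.isExposed, ?_⟩
  ext x
  constructor
  · rintro ⟨hx, hxmax⟩
    rw [mem_univ_pi] at hx
    have hle : ∀ k, l' k (x k) ≤ l' k (x₀ k) := fun k => hx₀' k _ (hx k)
    have h1 := hxmax x₀ (by rwa [mem_univ_pi])
    rw [hl, hl] at h1
    have heq := (Finset.sum_eq_sum_iff_of_le fun k _ => hle k).1
      (le_antisymm (Finset.sum_le_sum fun k _ => hle k) h1)
    intro k _
    exact ⟨hx k, fun y hy => (heq k (Finset.mem_univ k)) ▸ hx₀' k y hy⟩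
  · intro hx
    rw [mem_univ_pi] at hx
    refine ⟨by rw [mem_univ_pi]; exact fun k => (hx k).1, fun y hy => ?_⟩
    rw [mem_univ_pi] at hy
    rw [hl, hl]
    exact Finset.sum_le_sum fun k _ => (hx k).2 _ (hy k)

/-- The face poset of a product is the product of the face posets. -/
lemma nonempty_orderIso_face_pi (P : ∀ k, Set (E k)) :
    Nonempty ((∀ k, (Face (P k))ᵒᵈ) ≃o (Face (univ.pi P))ᵒᵈ) := by
  let f : (∀ k, (Face (P k))ᵒᵈ) → (Face (univ.pi P))ᵒᵈ := fun F =>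
    OrderDual.toDual ⟨univ.pi fun k => (OrderDual.ofDual (F k)).1,
      univ_pi_nonempty_iff.2 fun k => (OrderDual.ofDual (F k)).2.1,
      isExposed_univ_pi (fun k => (OrderDual.ofDual (F k)).2.1)
        fun k => (OrderDual.ofDual (F k)).2.2⟩
  have hf : ∀ F F', f F ≤ f F' ↔ F ≤ F' := by
    intro F F'
    change univ.pi (fun k => (OrderDual.ofDual (F' k)).1) ⊆
      univ.pi (fun k => (OrderDual.ofDual (F k)).1) ↔
      ∀ k, (OrderDual.ofDual (F' k)).1 ⊆ (OrderDual.ofDual (F k)).1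
    -- Products can be compared factor by factor because no factor is empty.
    rw [univ_pi_subset_univ_pi_iff, or_iff_left]
    rintro ⟨k, hk⟩
    exact (OrderDual.ofDual (F' k)).2.1.ne_empty hk
  refine ⟨RelIso.ofSurjective (OrderEmbedding.ofMapLEIff f hf) fun F => ?_⟩
  obtain ⟨F', hne, hexp, hF⟩ := exists_univ_pi_eq_of_isExposed (OrderDual.ofDual F).2.1
    (OrderDual.ofDual F).2.2
  exact ⟨fun k => OrderDual.toDual ⟨F' k, hne k, hexp k⟩, Subtype.ext hF.symm⟩

end Product

end GraphAssoc

/-! ### Roots: signs and supports -/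

namespace CoxeterMatrix

lemma simpleRoot_self {B : Type*} [DecidableEq B] (i : B) : simpleRoot i i = 1 := by
  simp [simpleRoot]

lemma simpleRoot_of_ne {B : Type*} [DecidableEq B] {i j : B} (h : j ≠ i) : simpleRoot i j = 0 := by
  simp [simpleRoot, h]

lemma cos_pos_of_adj {B : Type*} (M : CoxeterMatrix B) {i j : B} (h : M.diagram.Adj i j) :
    0 < Real.cos (Real.pi / M i j) := by
  rcases h.2 with h | h
  · simp [h]
  · have h3 : (3 : ℝ) ≤ M i j := by exact_mod_cast h
    apply Real.cos_pos_of_mem_Ioo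
    constructor
    · have : 0 ≤ Real.pi / M i j := by positivity
      linarith [Real.pi_pos]
    · rw [div_lt_div_iff₀ (by linarith) two_pos]
      nlinarith [Real.pi_pos]

lemma cos_eq_zero_of_not_adj {B : Type*} (M : CoxeterMatrix B) {i j : B} (hij : i ≠ j)
    (h : ¬ M.diagram.Adj i j) :
    Real.cos (Real.pi / M i j) = 0 := by
  have h2 : M i j = 2 := by
    have h1 := M.off_diagonal i j hij
    have h3 : ¬ (M i j = 0 ∨ 3 ≤ M i j) := fun h' => h ⟨hij, h'⟩
    omega
  rw [h2]
  exact_mod_cast Real.cos_pi_div_two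

lemma cos_nonneg_of_ne {B : Type*} (M : CoxeterMatrix B) {i j : B} (hij : i ≠ j) :
    0 ≤ Real.cos (Real.pi / M i j) := by
  by_cases h : M.diagram.Adj i j
  · exact (M.cos_pos_of_adj h).le
  · exact (M.cos_eq_zero_of_not_adj hij h).ge

variable {B : Type*} [Fintype B] [DecidableEq B] (M : CoxeterMatrix B)

lemma form_simpleRoot_right (v : B → ℝ) (j : B) :
    M.form v (simpleRoot j) = ∑ i, v i * -Real.cos (Real.pi / M i j) := by
  have hv : v = ∑ i, v i • simpleRoot i := by
    funext k
    simp [simpleRoot, Finset.sum_apply, Pi.single_apply]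
  conv_lhs => rw [hv]
  simp [form_simpleRoot]

lemma simpleReflection_apply_of_ne (i : B) (v : B → ℝ) {j : B} (h : j ≠ i) :
    M.simpleReflection i v j = v j := by
  simp [simpleReflection_apply, simpleRoot_of_ne h]

lemma simpleReflection_simpleRoot (i : B) :
    M.simpleReflection i (simpleRoot i) = -simpleRoot i := by
  rw [simpleReflection_apply, form_simpleRoot, M.diagonal]
  simp only [Nat.cast_one, div_one, Real.cos_pi, neg_neg, mul_one]
  module

lemma simpleReflection_simpleRoot' (i j : B) : M.simpleReflection i (simpleRoot j) =
    simpleRoot j + (2 * Real.cos (Real.pi / M i j)) • simpleRoot i := by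
  rw [simpleReflection_apply, form_simpleRoot, M.symmetric j i]
  module

/-! ### Roots in rank two -/

/-- The coefficients of the roots in a rank two subsystem: `sin (k θ) / sin θ`, `c = cos θ`. -/
def dihedralCoeff (c : ℝ) : ℕ → ℝ
  | 0 => 0
  | 1 => 1
  | k + 2 => 2 * c * dihedralCoeff c (k + 1) - dihedralCoeff c k

lemma dihedralCoeff_mul_sin (θ : ℝ) (k : ℕ) :
    dihedralCoeff (Real.cos θ) k * Real.sin θ = Real.sin (k * θ) := by
  induction k using Nat.twoStepInduction with
  | zero => simp [dihedralCoeff]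
  | one => simp [dihedralCoeff]
  | more k h1 h2 =>
    rw [dihedralCoeff, sub_mul, mul_assoc, h1, h2]
    have e1 : ((k + 2 : ℕ) : ℝ) * θ = ((k + 1 : ℕ) : ℝ) * θ + θ := by push_cast; ring
    have e2 : (k : ℝ) * θ = ((k + 1 : ℕ) : ℝ) * θ - θ := by push_cast; ring
    rw [e1, e2, Real.sin_add, Real.sin_sub]
    ring

/-- This is the case `m = ∞`: the entry `0` gives `c = cos 0 = 1`. -/
lemma dihedralCoeff_one (k : ℕ) : dihedralCoeff 1 k = k := by
  induction k using Nat.twoStepInduction with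
  | zero => simp [dihedralCoeff]
  | one => simp [dihedralCoeff]
  | more k h1 h2 => rw [dihedralCoeff, h1, h2]; push_cast; ring

/-- For finite `m`, the angle `k π / m` is still at most `π`, so the sine in the numerator is
nonnegative. -/
lemma dihedralCoeff_nonneg {m k : ℕ} (hm : m ≠ 1) (h : m = 0 ∨ k ≤ m) :
    0 ≤ dihedralCoeff (Real.cos (Real.pi / m)) k := by
  rcases Nat.eq_zero_or_pos m with rfl | hpos
  · simp [dihedralCoeff_one]
  have hk : k ≤ m := h.resolve_left hpos.ne'
  have hm2 : (2 : ℝ) ≤ m := by exact_mod_cast (by omega : 2 ≤ m)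
  have hθ0 : 0 < Real.pi / m := div_pos Real.pi_pos (by linarith)
  have hθπ : Real.pi / m < Real.pi := by
    rw [div_lt_iff₀ (by linarith)]
    nlinarith [Real.pi_pos]
  have hs : 0 < Real.sin (Real.pi / m) := Real.sin_pos_of_pos_of_lt_pi hθ0 hθπ
  have hsk : 0 ≤ Real.sin (k * (Real.pi / m)) := by
    apply Real.sin_nonneg_of_nonneg_of_le_pi (by positivity)
    have hk' : (k : ℝ) ≤ m := by exact_mod_cast hk
    rw [← mul_div_assoc, div_le_iff₀ (by linarith)]
    nlinarith [Real.pi_pos]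
  rw [← dihedralCoeff_mul_sin] at hsk
  exact nonneg_of_mul_nonneg_left hsk hs

end CoxeterMatrix

namespace CoxeterSystem

open Set CoxeterMatrix GraphAssoc

variable {B : Type*} [Fintype B] [DecidableEq B] {M : CoxeterMatrix B} {W : Type*} [Group W]
  (cs : CoxeterSystem M W)

lemma geomRep_simple (i : B) : cs.geomRep (cs.simple i) = M.simpleReflection i :=
  cs.lift_apply_simple M.isLiftable_simpleReflection i

lemma geomRep_mul_apply (w w' : W) (v : B → ℝ) :
    cs.geomRep (w * w') v = cs.geomRep w (cs.geomRep w' v) := by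
  rw [map_mul]; rfl

lemma geomRep_mul_simple_simpleRoot (w : W) (i : B) :
    cs.geomRep (w * cs.simple i) (simpleRoot i) = -cs.geomRep w (simpleRoot i) := by
  rw [geomRep_mul_apply, geomRep_simple, simpleReflection_simpleRoot, map_neg]

/-- The word ends in `t`, so `t` is the first to act on `α_s`; each further letter performs one step
of the recurrence of `dihedralCoeff`. -/
lemma geomRep_alternatingWord (s t : B) (m : ℕ) :
    cs.geomRep (cs.wordProd (alternatingWord s t m)) (simpleRoot s) =
      if Even m then dihedralCoeff (Real.cos (Real.pi / M s t)) (m + 1) • simpleRoot s +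
        dihedralCoeff (Real.cos (Real.pi / M s t)) m • simpleRoot t
      else dihedralCoeff (Real.cos (Real.pi / M s t)) m • simpleRoot s +
        dihedralCoeff (Real.cos (Real.pi / M s t)) (m + 1) • simpleRoot t := by
  induction m with
  | zero => simp [alternatingWord, dihedralCoeff]
  | succ m ih =>
    rw [alternatingWord_succ', wordProd_cons, geomRep_mul_apply, ih, geomRep_simple]
    by_cases hm : Even m
    · have hm' : ¬ Even (m + 1) := by rwa [Nat.even_add_one, not_not]
      simp only [hm, hm', if_true, if_false, map_add, map_smul, simpleReflection_simpleRoot,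
        simpleReflection_simpleRoot' M t s, M.symmetric t s, dihedralCoeff]
      module
    · have hm' : Even (m + 1) := by rwa [Nat.even_add_one]
      simp only [hm, hm', if_true, if_false, map_add, map_smul, simpleReflection_simpleRoot,
        simpleReflection_simpleRoot' M s t, dihedralCoeff]
      module

/-- Factor off a maximal alternating word in two generators. -/
lemma exists_eq_mul_alternatingWord {B : Type*} {M : CoxeterMatrix B} {W : Type*} [Group W]
    (cs : CoxeterSystem M W) {w : W} {s : B} (hs : ¬ cs.IsRightDescent w s) (t : B) :
    ∃ (m : ℕ) (v : W), w = v * cs.wordProd (alternatingWord s t m) ∧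
      cs.length v + m = cs.length w ∧ ¬ cs.IsRightDescent v s ∧ ¬ cs.IsRightDescent v t := by
  classical
  let p : ℕ → Prop := fun m => ∃ v : W, w = v * cs.wordProd (alternatingWord s t m) ∧
    cs.length v + m = cs.length w
  have h0 : p 0 := ⟨w, by simp [alternatingWord], by simp⟩
  set m := Nat.findGreatest p (cs.length w) with hm
  obtain ⟨v, hv, hlen⟩ : p m := Nat.findGreatest_spec (Nat.zero_le _) h0
  -- A descent here would extend the alternating word, against the choice of the largest `m`.
  have hnext : ¬ cs.IsRightDescent v (if Even m then t else s) := by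
    intro hd
    rw [isRightDescent_iff] at hd
    have hp : p (m + 1) := by
      refine ⟨v * cs.simple (if Even m then t else s), ?_, by omega⟩
      rw [alternatingWord_succ', wordProd_cons, ← mul_assoc, simple_mul_simple_cancel_right]
      exact hv
    have := Nat.le_findGreatest (P := p) (n := cs.length w) (by omega) hp
    omega
  -- For `m > 0` this letter is the first letter of the alternating word; a descent would cancel it
  -- and make `w` too short.
  have hprev : ¬ cs.IsRightDescent v (if Even m then s else t) := by
    rcases Nat.eq_zero_or_pos m with h | h
    · rw [h] at hv ⊢
      simp only [Even.zero, if_true]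
      have : v = w := by simpa [alternatingWord] using hv.symm
      rwa [this]
    · obtain ⟨k, hk⟩ : ∃ k, m = k + 1 := ⟨m - 1, by omega⟩
      intro hd
      rw [isRightDescent_iff] at hd
      have e : (if Even m then s else t) = (if Even k then t else s) := by
        rw [hk]
        by_cases h : Even k
        · rw [if_neg (by rwa [Nat.even_add_one, not_not]), if_pos h]
        · rw [if_pos (by rwa [Nat.even_add_one]), if_neg h]
      rw [e] at hd
      rw [hk, alternatingWord_succ', wordProd_cons, ← mul_assoc] at hv
      have h1 := cs.length_mul_le (v * cs.simple (if Even k then t else s))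
        (cs.wordProd (alternatingWord s t k))
      have h2 := cs.length_wordProd_le (alternatingWord s t k)
      rw [length_alternatingWord] at h2
      rw [← hv] at h1
      omega
  refine ⟨m, v, hv, hlen, ?_⟩
  by_cases hme : Even m
  · simp only [hme, if_true] at hnext hprev
    exact ⟨hprev, hnext⟩
  · simp only [hme, if_false] at hnext hprev
    exact ⟨hnext, hprev⟩

/-- If `w s` is longer than `w`, then `w α_s` is nonnegative. -/
theorem geomRep_simpleRoot_nonneg {w : W} {s : B} (hs : ¬ cs.IsRightDescent w s) :
    0 ≤ cs.geomRep w (simpleRoot s) := by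
  induction hn : cs.length w using Nat.strong_induction_on generalizing w s with
  | _ n ih =>
  by_cases hw : w = 1
  · subst hw
    rw [map_one]
    intro i
    by_cases hi : i = s
    · subst hi; simp [simpleRoot_self]
    · simp [simpleRoot_of_ne hi]
  obtain ⟨t, ht⟩ := cs.exists_rightDescent_of_ne_one hw
  have hst : s ≠ t := fun h => hs (h ▸ ht)
  -- The alternating factor sends `α_s` to a nonnegative combination of `α_s` and `α_t`, and by
  -- induction `v` sends both of these to nonnegative vectors.
  obtain ⟨m, v, hv, hlen, hvs, hvt⟩ := cs.exists_eq_mul_alternatingWord hs t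
  have hm : m ≠ 0 := by
    rintro rfl
    have : w = v := by simpa [alternatingWord] using hv
    exact hvt (this ▸ ht)
  -- Otherwise the alternating word with `s` appended is not reduced, and `w s` would not be longer
  -- than `w`.
  have hmM : M s t = 0 ∨ m + 1 ≤ M s t := by
    by_contra! hcon
    have hnr := cs.not_isReduced_alternatingWord t s (m := m + 1)
      (by rw [M.symmetric]; exact hcon.1) (by rw [M.symmetric]; exact hcon.2)
    have h1 := cs.length_wordProd_le (alternatingWord t s (m + 1))
    rw [length_alternatingWord] at h1
    have h2 : cs.length (cs.wordProd (alternatingWord t s (m + 1))) ≠ m + 1 := fun h =>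
      hnr (by rw [IsReduced, length_alternatingWord]; exact h)
    have h3 := cs.length_mul_le v (cs.wordProd (alternatingWord t s (m + 1)))
    rw [alternatingWord_succ, wordProd_concat, ← mul_assoc, ← hv] at h3
    rw [alternatingWord_succ, wordProd_concat] at h1 h2
    rw [not_isRightDescent_iff] at hs
    omega
  have hM1 := M.off_diagonal s t hst
  have hs0 : 0 ≤ cs.geomRep v (simpleRoot s) := ih (cs.length v) (by omega) hvs rfl
  have ht0 : 0 ≤ cs.geomRep v (simpleRoot t) := ih (cs.length v) (by omega) hvt rfl
  have hc1 := dihedralCoeff_nonneg (k := m + 1) hM1 hmM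
  have hc0 := dihedralCoeff_nonneg (k := m) hM1 (hmM.imp_right fun h => by omega)
  rw [hv, geomRep_mul_apply, geomRep_alternatingWord]
  split_ifs
  · rw [map_add, map_smul, map_smul]
    exact add_nonneg (smul_nonneg hc1 hs0) (smul_nonneg hc0 ht0)
  · rw [map_add, map_smul, map_smul]
    exact add_nonneg (smul_nonneg hc0 hs0) (smul_nonneg hc1 ht0)

/-- Every root is nonnegative or nonpositive. -/
theorem roots_nonneg_or_nonpos {β : B → ℝ} (hβ : β ∈ cs.roots) : 0 ≤ β ∨ β ≤ 0 := by
  obtain ⟨w, i, rfl⟩ := hβ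
  by_cases h : cs.IsRightDescent w i
  · right
    rw [isRightDescent_iff_not_isRightDescent_mul] at h
    have := cs.geomRep_simpleRoot_nonneg h
    rwa [geomRep_mul_simple_simpleRoot, Left.nonneg_neg_iff] at this
  · exact .inl (cs.geomRep_simpleRoot_nonneg h)

lemma geomRep_mem_roots (w : W) {β : B → ℝ} (hβ : β ∈ cs.roots) : cs.geomRep w β ∈ cs.roots := by
  obtain ⟨w', i, rfl⟩ := hβ
  exact ⟨w * w', i, (cs.geomRep_mul_apply _ _ _).symm⟩

lemma simpleReflection_mem_roots (i : B) {β : B → ℝ} (hβ : β ∈ cs.roots) :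
    M.simpleReflection i β ∈ cs.roots := by
  rw [← cs.geomRep_simple]; exact cs.geomRep_mem_roots _ hβ

lemma simpleRoot_mem_roots (i : B) : simpleRoot i ∈ cs.roots := ⟨1, i, by simp⟩

lemma simpleRoot_mem_posRoots (i : B) : simpleRoot i ∈ cs.posRoots := by
  refine ⟨cs.simpleRoot_mem_roots i, fun j => ?_⟩
  by_cases h : j = i
  · subst h; simp [simpleRoot_self]
  · simp [simpleRoot_of_ne h]

lemma ne_zero_of_mem_roots {β : B → ℝ} (hβ : β ∈ cs.roots) : β ≠ 0 := by
  obtain ⟨w, i, rfl⟩ := hβ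
  intro h
  rw [LinearEquiv.map_eq_zero_iff] at h
  have := congrFun h i
  rw [simpleRoot_self] at this
  exact one_ne_zero this

/-- Induction on the length of `w`, split off at a right descent `j`, with `w = w₁ s_j`. If `(β,
α_j) ≤ 0`, then `w₁` already makes `β` nonpositive, as `w₁ α_j ≥ 0`. Otherwise pass to `s_j β`. If
it is nonpositive, `β` is supported at `j`. If it is nonnegative, its support is connected by
induction, and `β` adds at most `j`; when `j` is new, `(s_j β, α_j) ≠ 0` gives an edge from the old
support to `j`. -/
lemma connected_support_of_geomRep_nonpos {β : B → ℝ} (hβ : β ∈ cs.roots) (h0 : 0 ≤ β) {w : W}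
    (hw : cs.geomRep w β ≤ 0) : (M.diagram.induce (Function.support β)).Connected := by
  induction hn : cs.length w using Nat.strong_induction_on generalizing w β with
  | _ n ih =>
  have hw1 : w ≠ 1 := by
    rintro rfl
    rw [map_one] at hw
    exact cs.ne_zero_of_mem_roots hβ (le_antisymm hw h0)
  obtain ⟨j, hj⟩ := cs.exists_rightDescent_of_ne_one hw1
  set w₁ := w * cs.simple j with hw₁
  have hww : w = w₁ * cs.simple j := by rw [hw₁, simple_mul_simple_cancel_right]
  have hlen : cs.length w₁ < n := hn ▸ hj
  set p := M.form β (simpleRoot j) with hp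
  have hwβ : cs.geomRep w β = cs.geomRep w₁ (M.simpleReflection j β) := by
    rw [hww, geomRep_mul_apply, geomRep_simple]
  have hrefl := M.simpleReflection_apply j β
  rw [← hp] at hrefl
  rcases le_or_gt p 0 with hp0 | hp0
  · have hpos : 0 ≤ cs.geomRep w₁ (simpleRoot j) :=
      cs.geomRep_simpleRoot_nonneg (by rwa [hw₁, ← isRightDescent_iff_not_isRightDescent_mul])
    refine ih (cs.length w₁) hlen hβ h0 (w := w₁) ?_ rfl
    rw [hwβ, hrefl, map_sub, map_smul] at hw
    have h2 : (2 * p) • cs.geomRep w₁ (simpleRoot j) ≤ 0 :=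
      smul_nonpos_of_nonpos_of_nonneg (by linarith) hpos
    calc cs.geomRep w₁ β = (cs.geomRep w₁ β - (2 * p) • cs.geomRep w₁ (simpleRoot j)) +
          (2 * p) • cs.geomRep w₁ (simpleRoot j) := by module
      _ ≤ 0 := add_nonpos hw h2
  · have hβ' := cs.simpleReflection_mem_roots j hβ
    have hne : ∀ i, i ≠ j → M.simpleReflection j β i = β i := fun i hi =>
      M.simpleReflection_apply_of_ne j β hi
    rcases cs.roots_nonneg_or_nonpos hβ' with h | h
    · have hconn := ih (cs.length w₁) hlen hβ' h (w := w₁) (hwβ ▸ hw) rfl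
      have hβj : 0 < β j := by
        have h1 : (0 : ℝ) ≤ M.simpleReflection j β j := h j
        rw [hrefl] at h1
        simp only [Pi.sub_apply, Pi.smul_apply, simpleRoot_self, smul_eq_mul, mul_one] at h1
        linarith
      have hsupp : Function.support β = Function.support (M.simpleReflection j β) ∪ {j} := by
        ext i
        by_cases hi : i = j
        · subst hi; simp [hβj.ne']
        · simp [hne i hi, hi]
      rw [hsupp]
      by_cases hj' : j ∈ Function.support (M.simpleReflection j β)
      · rwa [union_singleton, insert_eq_of_mem hj']
      · have hform : M.form (M.simpleReflection j β) (simpleRoot j) = -p := by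
          rw [hrefl, map_sub, LinearMap.sub_apply, map_smul, LinearMap.smul_apply, form_simpleRoot,
            M.diagonal, ← hp]
          simp only [Nat.cast_one, div_one, Real.cos_pi, smul_eq_mul]
          ring
        obtain ⟨i, hi, hadj⟩ : ∃ i ∈ Function.support (M.simpleReflection j β),
            M.diagram.Adj i j := by
          by_contra! hcon
          rw [form_simpleRoot_right, Finset.sum_eq_zero] at hform
          · linarith
          · intro i _
            by_cases hi : i ∈ Function.support (M.simpleReflection j β)
            · rw [M.cos_eq_zero_of_not_adj (fun h => by rw [h] at hi; exact hj' hi) (hcon i hi)]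
              simp
            · rw [Function.notMem_support.1 hi, zero_mul]
        exact connected_union_of_adj hconn (connected_singleton j) hi rfl hadj
    · have hzero : ∀ i, i ≠ j → β i = 0 := fun i hi =>
        le_antisymm (hne i hi ▸ h i) (h0 i)
      have hsupp : Function.support β = {j} := by
        refine Subset.antisymm (fun i hi => ?_) ?_
        · by_contra hij
          exact hi (hzero i hij)
        · rw [singleton_subset_iff]
          intro hβj
          refine cs.ne_zero_of_mem_roots hβ (funext fun i => ?_)
          by_cases hi : i = j
          · rw [hi]; exact hβj
          · exact hzero i hi
      rw [hsupp]
      exact connected_singleton j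

/-- The support of a positive root is connected. -/
theorem connected_support_of_mem_posRoots {β : B → ℝ} (hβ : β ∈ cs.posRoots) :
    (M.diagram.induce (Function.support β)).Connected := by
  obtain ⟨w, i, h⟩ := hβ.1
  -- For `β = w α_i`, the element `s_i w⁻¹` sends `β` to `-α_i`.
  refine cs.connected_support_of_geomRep_nonpos hβ.1 hβ.2 (w := cs.simple i * w⁻¹) ?_
  rw [h, ← geomRep_mul_apply, mul_assoc, inv_mul_cancel, mul_one, geomRep_simple,
    simpleReflection_simpleRoot]
  exact Left.neg_nonpos_iff.2 (cs.simpleRoot_mem_posRoots i).2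

/-- Every connected set of nodes is the support of a positive root. -/
theorem exists_posRoot_support_eq {J : Set B} (hJ : (M.diagram.induce J).Connected) :
    ∃ β ∈ cs.posRoots, Function.support β = J := by
  obtain ⟨a, ha⟩ := nonempty_of_connected hJ
  -- Take a maximal support inside `J`. If it missed part of `J`, reflecting in an adjacent node of
  -- `J` would enlarge it.
  obtain ⟨K, hK⟩ := (Set.toFinite {K : Set B | K ⊆ J ∧ ∃ β ∈ cs.posRoots,
    Function.support β = K}).exists_maximal ⟨Function.support (simpleRoot a), by
      intro i hi
      by_contra hiJ
      exact hi (simpleRoot_of_ne fun h => hiJ (h ▸ ha)), _, cs.simpleRoot_mem_posRoots a, rfl⟩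
  obtain ⟨hKJ, β, hβ, hβK⟩ := hK.prop
  refine ⟨β, hβ, ?_⟩
  rw [hβK]
  refine hKJ.antisymm ?_
  by_contra hcon
  have hKne : (J ∩ K).Nonempty := by
    rw [inter_eq_right.2 hKJ, ← hβK]
    exact Function.support_nonempty_iff.2 (cs.ne_zero_of_mem_roots hβ.1)
  obtain ⟨i, hi, j, hj, hadj⟩ := exists_adj_of_connected_of_not_subset hJ hKne hcon
  have hβj : β j = 0 := Function.notMem_support.1 (by rw [hβK]; exact hj.2)
  -- The terms of the form are all nonpositive, since `β` vanishes at `j`, and the edge from `i`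
  -- contributes a negative one.
  have hneg : M.form β (simpleRoot j) < 0 := by
    rw [form_simpleRoot_right]
    refine Finset.sum_neg' (fun k _ => ?_) ⟨i, Finset.mem_univ i, ?_⟩
    · by_cases hk : k = j
      · rw [hk, hβj, zero_mul]
      · have := mul_nonneg (hβ.2 k) (M.cos_nonneg_of_ne hk)
        linarith
    · have hβi : 0 < β i := lt_of_le_of_ne (hβ.2 i) (Ne.symm (by
        have := hi.1; rw [← hβK] at this; exact this))
      have := mul_pos hβi (M.cos_pos_of_adj hadj)
      linarith
  have hrj : 0 < M.simpleReflection j β j := by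
    rw [simpleReflection_apply]
    simp only [Pi.sub_apply, Pi.smul_apply, simpleRoot_self, smul_eq_mul, mul_one]
    linarith
  have hmem : M.simpleReflection j β ∈ cs.posRoots := by
    refine ⟨cs.simpleReflection_mem_roots j hβ.1, fun k => ?_⟩
    by_cases hk : k = j
    · rw [hk]; exact hrj.le
    · rw [M.simpleReflection_apply_of_ne j β hk]; exact hβ.2 k
  refine hj.2 (hK.le_of_ge (y := Function.support (M.simpleReflection j β)) ⟨?_, _, hmem, rfl⟩ ?_
    (show j ∈ Function.support (M.simpleReflection j β) from hrj.ne'))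
  · intro k hk
    by_cases hkj : k = j
    · rw [hkj]; exact hj.1
    · rw [Function.mem_support, M.simpleReflection_apply_of_ne j β hkj] at hk
      exact hKJ (hβK ▸ hk)
  · intro k hk
    have hkj : k ≠ j := fun h => hj.2 (h ▸ hk)
    rw [Function.mem_support, M.simpleReflection_apply_of_ne j β hkj]
    rw [← hβK] at hk
    exact hk

end CoxeterSystem

/-! ### Bases of the matroid of a flag -/

namespace Bergman

open Set

section

variable {α : Type*} {M : Matroid α}

lemma isBase_contract_iff {X I B : Set α} (hI : M.IsBasis I X) :
    (M.contract X).IsBase B ↔ M.IsBase (B ∪ I) ∧ Disjoint B X := by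
  constructor
  · intro hB
    obtain ⟨hind, hdisj⟩ := hI.contract_indep_iff.1 hB.indep
    refine ⟨hind.isBase_of_forall_insert fun e he hins => ?_, hdisj.symm⟩
    have heX : e ∉ X := fun heX => he.2 (.inr (hI.mem_of_insert_indep heX
      (hins.subset (insert_subset_insert subset_union_right))))
    have h2 : (M.contract X).Indep (insert e B) := by
      rw [hI.contract_indep_iff, insert_union]
      exact ⟨hins, disjoint_insert_right.2 ⟨heX, hdisj⟩⟩
    exact he.2 (.inl (hB.eq_of_subset_indep h2 (subset_insert _ _) ▸ mem_insert e B))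
  · rintro ⟨hB, hdisj⟩
    refine (hI.contract_indep_iff.2 ⟨hB.indep, hdisj.symm⟩).isBase_of_forall_insert
      fun e he hins => ?_
    obtain ⟨hind, hdisj'⟩ := hI.contract_indep_iff.1 hins
    rw [insert_union] at hind
    have := hB.eq_of_subset_indep hind (subset_insert _ _)
    rcases (this ▸ mem_insert e (B ∪ I) : e ∈ B ∪ I) with h | h
    · exact he.2 h
    · exact disjoint_left.1 hdisj' (hI.subset h) (mem_insert e B)

lemma pred_eq_empty_or_mem {𝓕 : Set (Set α)} (hfin : 𝓕.Finite) (hchain : IsChain (· ⊆ ·) 𝓕)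
    (F : Set α) : pred 𝓕 F = ∅ ∨ (pred 𝓕 F ∈ 𝓕 ∧ pred 𝓕 F ⊂ F) := by
  rcases eq_empty_or_nonempty {G ∈ 𝓕 | G ⊂ F} with h | h
  · left; rw [pred, h, sUnion_empty]
  · obtain ⟨m, hm⟩ := (hfin.subset (sep_subset 𝓕 (· ⊂ F))).exists_maximal h
    right
    have : pred 𝓕 F = m := by
      refine Subset.antisymm (sUnion_subset fun G hG => ?_) (subset_sUnion_of_mem hm.prop)
      rcases hchain.total hG.1 hm.prop.1 with h | h
      · exact h
      · exact hm.le_of_ge hG h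
    rw [this]; exact hm.prop

lemma pred_subset (𝓕 : Set (Set α)) (F : Set α) : pred 𝓕 F ⊆ F :=
  sUnion_subset fun _ hG => hG.2.subset

lemma exists_mem_sdiff_pred {𝓕 : Set (Set α)} (hfin : 𝓕.Finite) {x : α} (hx : x ∈ M.E) :
    ∃ F ∈ insert M.E 𝓕, x ∈ F \ pred 𝓕 F := by
  obtain ⟨F, hF⟩ := ((hfin.insert M.E).subset
    (sep_subset (insert M.E 𝓕) (x ∈ ·))).exists_minimal ⟨M.E, mem_insert _ _, hx⟩
  refine ⟨F, hF.prop.1, hF.prop.2, ?_⟩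
  rintro ⟨G, ⟨hG, hGF⟩, hxG⟩
  exact hGF.2 (hF.le_of_le ⟨mem_insert_of_mem _ hG, hxG⟩ hGF.subset)

lemma flagMatroid_ground {𝓕 : Set (Set α)} (hfin : 𝓕.Finite) (hsub : ∀ F ∈ 𝓕, F ⊆ M.E)
    (hchain : IsChain (· ⊆ ·) 𝓕) : (flagMatroid M 𝓕 hsub hchain).E = M.E := by
  refine Matroid.disjointSigma_ground_eq.trans ?_
  refine Subset.antisymm (iUnion_subset ?_) fun x hx => ?_
  · rintro ⟨F, rfl | hF⟩ x hx
    · exact hx.1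
    · exact hsub F hF hx.1
  · obtain ⟨F, hF, hxF⟩ := exists_mem_sdiff_pred hfin hx
    exact mem_iUnion.2 ⟨⟨F, hF⟩, hxF⟩

/-- The bases of the matroid of a flag are the bases of `M` that contain a basis of each member of
the flag. -/
lemma flagMatroid_isBase_iff {𝓕 : Set (Set α)} (hfin : 𝓕.Finite) (hsub : ∀ F ∈ 𝓕, F ⊆ M.E)
    (hchain : IsChain (· ⊆ ·) 𝓕) (B : Set α) :
    (flagMatroid M 𝓕 hsub hchain).IsBase B ↔
      B ⊆ M.E ∧ ∀ F ∈ insert M.E 𝓕, M.IsBasis (B ∩ F) F := by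
  have hsub' : ∀ F ∈ insert M.E 𝓕, F ⊆ M.E := by
    rintro F (rfl | hF)
    · exact Subset.rfl
    · exact hsub F hF
  -- A basis of `F / pred F` together with a basis of `pred F` is a basis of `F`.
  have key : ∀ F ∈ insert M.E 𝓕, M.IsBasis (B ∩ pred 𝓕 F) (pred 𝓕 F) →
      (((M.restrict F).contract (pred 𝓕 F)).IsBase (B ∩ (F \ pred 𝓕 F)) ↔
        M.IsBasis (B ∩ F) F) := by
    intro F hF hp
    have hp' : (M.restrict F).IsBasis (B ∩ pred 𝓕 F) (pred 𝓕 F) :=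
      (Matroid.isBasis_restrict_iff (hsub' F hF)).2 ⟨hp, pred_subset 𝓕 F⟩
    rw [isBase_contract_iff hp', Matroid.isBase_restrict_iff (hsub' F hF),
      ← inter_union_distrib_left, sdiff_union_of_subset (pred_subset 𝓕 F)]
    exact and_iff_left (disjoint_sdiff_left.mono_left inter_subset_right)
  have hground : (⋃ F : (insert M.E 𝓕 : Set (Set α)),
      ((M.restrict F.1).contract (pred 𝓕 F.1)).E) = M.E :=
    Matroid.disjointSigma_ground_eq.symm.trans (flagMatroid_ground hfin hsub hchain)
  refine Matroid.disjointSigma_isBase_iff.trans ?_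
  rw [hground, and_comm]
  refine and_congr_right fun _ => ?_
  constructor
  · intro h F hF
    -- Induction on the number of members below `F`, each step passing from the predecessor to `F`.
    have hwf : ∀ n, ∀ F ∈ insert M.E 𝓕, {G ∈ 𝓕 | G ⊂ F}.ncard = n → M.IsBasis (B ∩ F) F := by
      intro n
      induction n using Nat.strong_induction_on with
      | _ n ih =>
      intro F hF hn
      refine (key F hF ?_).1 (h ⟨F, hF⟩)
      rcases pred_eq_empty_or_mem hfin hchain F with h0 | ⟨h1, h2⟩
      · rw [h0, inter_empty, Matroid.isBasis_empty_iff]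
      · refine ih _ ?_ _ (mem_insert_of_mem _ h1) rfl
        rw [← hn]
        refine ncard_lt_ncard ⟨fun G hG => ⟨hG.1, hG.2.trans h2⟩, fun hcon => ?_⟩
          (hfin.subset (sep_subset _ _))
        exact (hcon (⟨h1, h2⟩ : pred 𝓕 F ∈ {G ∈ 𝓕 | G ⊂ F})).2.ne rfl
    exact hwf _ F hF rfl
  · rintro h ⟨F, hF⟩
    refine (key F hF ?_).2 (h F hF)
    rcases pred_eq_empty_or_mem hfin hchain F with h0 | ⟨h1, -⟩
    · rw [h0, inter_empty, Matroid.isBasis_empty_iff]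
    · exact h _ (mem_insert_of_mem _ h1)

end

section

variable {V : Type*} [AddCommGroup V] [Module ℝ V] {E : Set V}

lemma linearMatroid_indep_iff {I : Set V} :
    (linearMatroid E).Indep I ↔ I ⊆ E ∧ LinearIndepOn ℝ id I := Iff.rfl

lemma linearMatroid_isBasis_iff {I X : Set V} (hX : X ⊆ E) :
    (linearMatroid E).IsBasis I X ↔
      I ⊆ X ∧ LinearIndepOn ℝ id I ∧ X ⊆ Submodule.span ℝ I := by
  constructor
  · intro h
    have hind := linearMatroid_indep_iff.1 h.indep
    refine ⟨h.subset, hind.2, fun x hx => ?_⟩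
    by_contra hxI
    exact hxI (Submodule.subset_span (h.mem_of_insert_indep hx
      (linearMatroid_indep_iff.2 ⟨insert_subset (hX hx) hind.1, hind.2.id_insert hxI⟩)))
  · rintro ⟨hIX, hI, hspan⟩
    refine (Matroid.isBasis_iff hX).2 ⟨linearMatroid_indep_iff.2 ⟨hIX.trans hX, hI⟩, hIX,
      fun J hJ hIJ hJX => hIJ.antisymm fun x hx => ?_⟩
    by_contra hxI
    have h2 := (linearMatroid_indep_iff.1 hJ).2.mono (insert_subset hx hIJ)
    exact ((linearIndepOn_id_insert hxI).1 h2).2 (hspan (hJX hx))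

end

end Bergman

/-! ### Positive flats and flags -/

namespace CoxeterSystem

open Set CoxeterMatrix GraphAssoc

variable {B : Type*} [Fintype B] [DecidableEq B] {M : CoxeterMatrix B} {W : Type*} [Group W]
  (cs : CoxeterSystem M W)

/-- The positive roots of the standard parabolic subgroup generated by `J`. -/
def parabolicRoots (J : Set B) : Set (B → ℝ) := {a ∈ cs.posRoots | Function.support a ⊆ J}

lemma simpleRoot_mem_parabolicRoots {J : Set B} {i : B} :
    simpleRoot i ∈ cs.parabolicRoots J ↔ i ∈ J := by
  refine ⟨fun h => h.2 (by simp [simpleRoot]), fun h =>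
    ⟨cs.simpleRoot_mem_posRoots i, fun j hj => ?_⟩⟩
  by_contra hjJ
  exact hj (simpleRoot_of_ne fun hji => hjJ (hji ▸ h))

lemma parabolicRoots_subset_iff {J K : Set B} :
    cs.parabolicRoots J ⊆ cs.parabolicRoots K ↔ J ⊆ K :=
  ⟨fun h _ hi => cs.simpleRoot_mem_parabolicRoots.1 (h (cs.simpleRoot_mem_parabolicRoots.2 hi)),
    fun h _ ha => ⟨ha.1, ha.2.trans h⟩⟩

lemma parabolicRoots_injective : Function.Injective cs.parabolicRoots := fun _ _ h =>
  (cs.parabolicRoots_subset_iff.1 h.le).antisymm (cs.parabolicRoots_subset_iff.1 h.ge)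

lemma parabolicRoots_empty : cs.parabolicRoots ∅ = ∅ := by
  refine eq_empty_of_forall_notMem fun a ha => cs.ne_zero_of_mem_roots ha.1.1 ?_
  exact Function.support_eq_empty_iff.1 (subset_empty_iff.1 ha.2)

lemma parabolicRoots_univ : cs.parabolicRoots univ = cs.posRoots :=
  Subset.antisymm (fun _ h => h.1) fun _ h => ⟨h, subset_univ _⟩

lemma span_subset_of_parabolicRoots {I : Set (B → ℝ)} {J : Set B} (hI : I ⊆ cs.parabolicRoots J)
    {x : B → ℝ} (hx : x ∈ Submodule.span ℝ I) : Function.support x ⊆ J := by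
  intro i hi
  by_contra hiJ
  have : Submodule.span ℝ I ≤ LinearMap.ker (LinearMap.proj i : (B → ℝ) →ₗ[ℝ] ℝ) :=
    Submodule.span_le.2 fun a ha => by
      by_contra h
      exact hiJ ((hI ha).2 h)
  exact hi (this hx)

/-- The sum of the coordinates outside `J` is the positive covector. These coordinate functionals
lie in the fundamental chamber, hence in the Tits cone, and span the annihilator, so the flat is
parabolic. -/
lemma isPositiveFlat_parabolicRoots (J : Set B) : cs.IsPositiveFlat (cs.parabolicRoots J) := by
  classical
  refine ⟨⟨⟨fun I X hI hX => ?_, fun a ha => ha.1⟩, ?_⟩,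
    ∑ i ∈ Jᶜ.toFinset, LinearMap.proj i, fun a ha => ?_, ?_⟩
  · have hXE : X ⊆ cs.posRoots := hX.subset_ground
    have hspan := ((Bergman.linearMatroid_isBasis_iff hXE).1 hX).2.2
    exact fun x hx => ⟨hXE hx, cs.span_subset_of_parabolicRoots hI.subset (hspan hx)⟩
  · refine le_antisymm (Submodule.span_le.2 inter_subset_left) fun f hf => ?_
    have hf0 : ∀ i ∈ J, f (simpleRoot i) = 0 := fun i hi =>
      (Submodule.mem_dualAnnihilator _).1 hf _
        (Submodule.subset_span (cs.simpleRoot_mem_parabolicRoots.2 hi))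
    have hfsum : f = ∑ i, f (simpleRoot i) • (LinearMap.proj i : (B → ℝ) →ₗ[ℝ] ℝ) := by
      refine LinearMap.pi_ext' fun j => LinearMap.ext_ring ?_
      simp [simpleRoot, Pi.single_apply]
    rw [hfsum]
    refine Submodule.sum_mem _ fun i _ => ?_
    by_cases hi : i ∈ J
    · rw [hf0 i hi, zero_smul]; exact Submodule.zero_mem _
    · refine Submodule.smul_mem _ _ (Submodule.subset_span ⟨?_, 1, fun j => ?_⟩)
      · refine (Submodule.mem_dualAnnihilator _).2 fun x hx => ?_
        by_contra h
        exact hi (cs.span_subset_of_parabolicRoots Subset.rfl hx h)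
      · rw [map_one]
        exact (cs.simpleRoot_mem_posRoots j).2 i
  · rw [LinearMap.sum_apply]
    exact Finset.sum_nonneg fun i _ => ha.2 i
  · ext a
    refine and_congr_right fun ha => ?_
    have hnn : ∀ i ∈ Jᶜ.toFinset, 0 ≤ (LinearMap.proj i : (B → ℝ) →ₗ[ℝ] ℝ) a := fun i _ => ha.2 i
    rw [LinearMap.sum_apply, Finset.sum_eq_zero_iff_of_nonneg hnn]
    constructor
    · intro h i hi
      by_contra hai
      exact (by simpa using hi : i ∉ J) (h hai)
    · intro h i hi
      by_contra hiJ
      exact hi (h i (by simpa using hiJ))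

/-- The positive flats are the sets of positive roots of standard parabolic subgroups. -/
lemma IsPositiveFlat.exists_eq {cs : CoxeterSystem M W} {F : Set (B → ℝ)}
    (hF : cs.IsPositiveFlat F) : ∃ J, F = cs.parabolicRoots J := by
  obtain ⟨-, f, hf0, rfl⟩ := hF
  refine ⟨{i | f (simpleRoot i) = 0}, ?_⟩
  ext a
  refine and_congr_right fun ha => ?_
  -- All terms are nonnegative, so `f a` vanishes iff `f` vanishes on each simple root in the
  -- support of `a`.
  have hsum : f a = ∑ i, a i * f (simpleRoot i) := by
    conv_lhs => rw [← Finset.univ_sum_single a]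
    rw [map_sum]
    refine Finset.sum_congr rfl fun i _ => ?_
    have : (Pi.single i (a i) : B → ℝ) = a i • simpleRoot i := by
      rw [simpleRoot, ← Pi.single_smul, smul_eq_mul, mul_one]
    rw [this, map_smul, smul_eq_mul]
  rw [hsum, Finset.sum_eq_zero_iff_of_nonneg fun i _ =>
    mul_nonneg (ha.2 i) (hf0 _ (cs.simpleRoot_mem_posRoots i))]
  constructor
  · intro h i hi
    exact (mul_eq_zero.1 (h i (Finset.mem_univ i))).resolve_left hi
  · intro h i _
    by_cases hi : a i = 0
    · rw [hi, zero_mul]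
    · have : f (simpleRoot i) = 0 := h hi
      rw [this, mul_zero]

/-! ### Flags of positive flats as chains of sets of nodes -/

namespace PosFlag

variable {cs}

/-- The flag of subsets of the diagram that corresponds to a flag of positive flats. -/
def sets (𝓕 : cs.PosFlag) : Set (Set B) := {J | cs.parabolicRoots J ∈ 𝓕.carrier}

lemma image_sets (𝓕 : cs.PosFlag) : cs.parabolicRoots '' 𝓕.sets = 𝓕.carrier := by
  refine Subset.antisymm (by rintro _ ⟨J, hJ, rfl⟩; exact hJ) fun F hF => ?_
  obtain ⟨J, rfl⟩ := (𝓕.positive F hF).exists_eq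
  exact ⟨J, hF, rfl⟩

lemma isChain_sets (𝓕 : cs.PosFlag) : IsChain (· ⊆ ·) 𝓕.sets := fun J hJ K hK hne => by
  have := 𝓕.chain hJ hK (cs.parabolicRoots_injective.ne hne)
  simpa only [parabolicRoots_subset_iff] using this

lemma ne_of_mem_sets (𝓕 : cs.PosFlag) : ∀ J ∈ 𝓕.sets, J ≠ ∅ ∧ J ≠ univ := by
  refine fun J hJ => ⟨?_, ?_⟩
  · rintro rfl
    exact 𝓕.ne_empty _ hJ cs.parabolicRoots_empty
  · rintro rfl
    exact 𝓕.ne_ground _ hJ cs.parabolicRoots_univ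

/-- The flag of positive flats that corresponds to a flag of subsets of the diagram. -/
def ofSets (cs : CoxeterSystem M W) (𝓒 : Set (Set B)) (hchain : IsChain (· ⊆ ·) 𝓒)
    (hne : ∀ J ∈ 𝓒, J ≠ ∅ ∧ J ≠ univ) : cs.PosFlag where
  carrier := cs.parabolicRoots '' 𝓒
  finite := (Set.toFinite 𝓒).image _
  positive := by
    rintro _ ⟨J, -, rfl⟩
    exact cs.isPositiveFlat_parabolicRoots J
  ne_empty := by
    rintro _ ⟨J, hJ, rfl⟩ h
    exact (hne J hJ).1 (cs.parabolicRoots_injective (h.trans cs.parabolicRoots_empty.symm))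
  ne_ground := by
    rintro _ ⟨J, hJ, rfl⟩ h
    exact (hne J hJ).2 (cs.parabolicRoots_injective (h.trans cs.parabolicRoots_univ.symm))
  chain := by
    rintro _ ⟨J, hJ, rfl⟩ _ ⟨K, hK, rfl⟩ -
    simp only [parabolicRoots_subset_iff]
    exact hchain.total hJ hK

lemma sets_ofSets (𝓒 : Set (Set B)) (hchain : IsChain (· ⊆ ·) 𝓒)
    (hne : ∀ J ∈ 𝓒, J ≠ ∅ ∧ J ≠ univ) : (ofSets cs 𝓒 hchain hne).sets = 𝓒 := by
  ext J
  exact cs.parabolicRoots_injective.mem_set_image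

end PosFlag

/-- The positive roots with support in `J` that belong to `I` span all of these roots. -/
def SpansParabolic (I : Set (B → ℝ)) (J : Set B) : Prop :=
  ∀ j ∈ J, simpleRoot j ∈ Submodule.span ℝ (I ∩ cs.parabolicRoots J)

lemma spansParabolic_iff_subset {I : Set (B → ℝ)} {J : Set B} :
    cs.SpansParabolic I J ↔
      cs.parabolicRoots J ⊆ Submodule.span ℝ (I ∩ cs.parabolicRoots J) := by
  refine ⟨fun h a ha => ?_, fun h j hj => h (cs.simpleRoot_mem_parabolicRoots.2 hj)⟩
  have hsum : a = ∑ i, a i • simpleRoot i := by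
    funext k
    simp [simpleRoot, Finset.sum_apply, Pi.single_apply]
  rw [SetLike.mem_coe, hsum]
  refine Submodule.sum_mem _ fun i _ => ?_
  by_cases hi : i ∈ J
  · exact Submodule.smul_mem _ _ (h i hi)
  · have : a i = 0 := by
      by_contra hai
      exact hi (ha.2 hai)
    rw [this, zero_smul]
    exact Submodule.zero_mem _

/-- Spanning can be tested on the components, since positive roots have connected support. -/
lemma spansParabolic_iff_comps {I : Set (B → ℝ)} {J : Set B} :
    cs.SpansParabolic I J ↔ ∀ C, IsComp M.diagram J C → cs.SpansParabolic I C := by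
  classical
  constructor
  · intro h C hC j hj
    -- The projection to the coordinates in `C` fixes the roots supported in `C` and kills the other
    -- roots supported in `J`, whose connected supports avoid `C`.
    let p : (B → ℝ) →ₗ[ℝ] (B → ℝ) := LinearMap.pi fun i => if i ∈ C then LinearMap.proj i else 0
    have hp : ∀ x i, p x i = if i ∈ C then x i else 0 := fun x i => by
      by_cases hi : i ∈ C <;> simp [p, hi]
    have hpj : p (simpleRoot j) = simpleRoot j := by
      funext i
      rw [hp]
      split_ifs with hi
      · rfl
      · rw [simpleRoot_of_ne fun h : i = j => hi (h ▸ hj)]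
    rw [← hpj]
    have hle : Submodule.span ℝ (I ∩ cs.parabolicRoots J) ≤
        (Submodule.span ℝ (I ∩ cs.parabolicRoots C)).comap p := by
      refine Submodule.span_le.2 fun a ha => ?_
      change p a ∈ Submodule.span ℝ (I ∩ cs.parabolicRoots C)
      by_cases hne : (Function.support a ∩ C).Nonempty
      · have hsub : Function.support a ⊆ C := hC.subset_of_inter
          (cs.connected_support_of_mem_posRoots ha.2.1) ha.2.2 hne
        have : p a = a := by
          funext i
          rw [hp]
          split_ifs with hi
          · rfl
          · exact (Function.notMem_support.1 fun h => hi (hsub h)).symm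
        rw [this]
        exact Submodule.subset_span ⟨ha.1, ha.2.1, hsub⟩
      · have : p a = 0 := by
          funext i
          rw [hp]
          split_ifs with hi
          · by_contra hai
            exact hne ⟨i, hai, hi⟩
          · rfl
        rw [this]
        exact Submodule.zero_mem _
    exact hle (h j (hC.1 hj))
  · intro h j hj
    obtain ⟨C, hC, hjC⟩ := exists_isComp (G := M.diagram) hj
    exact Submodule.span_mono (inter_subset_inter_right _ (cs.parabolicRoots_subset_iff.2 hC.1))
      (h C hC j hjC)

/-! ### The matroid of a flag and the components of its members -/

namespace PosFlag

variable {cs}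

/-- The components of the members of a flag, including those of the whole diagram. -/
def tubes (𝓕 : cs.PosFlag) : Set (Set B) := comps M.diagram (insert univ 𝓕.sets)

lemma isChain_insert_univ_sets (𝓕 : cs.PosFlag) : IsChain (· ⊆ ·) (insert univ 𝓕.sets) :=
  𝓕.isChain_sets.insert fun _ _ _ => .inr (subset_univ _)

lemma matroid_isBase_iff (𝓕 : cs.PosFlag) (I : Set (B → ℝ)) :
    𝓕.matroid.IsBase I ↔ I ⊆ cs.posRoots ∧ LinearIndepOn ℝ id I ∧
      ∀ J ∈ insert univ 𝓕.sets, cs.SpansParabolic I J := by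
  rw [PosFlag.matroid, Bergman.flagMatroid_isBase_iff 𝓕.finite]
  refine and_congr_right fun hI => ?_
  have hE : cs.rootMatroid.E = cs.parabolicRoots univ := cs.parabolicRoots_univ.symm
  have hins : insert cs.rootMatroid.E 𝓕.carrier = cs.parabolicRoots '' insert univ 𝓕.sets := by
    rw [image_insert_eq, image_sets, hE]
  rw [hins, forall_mem_image]
  have hbasis : ∀ J, cs.rootMatroid.IsBasis (I ∩ cs.parabolicRoots J) (cs.parabolicRoots J) ↔
      LinearIndepOn ℝ id (I ∩ cs.parabolicRoots J) ∧ cs.SpansParabolic I J := by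
    intro J
    rw [rootMatroid, Bergman.linearMatroid_isBasis_iff fun a ha => ha.1,
      spansParabolic_iff_subset]
    exact and_iff_right inter_subset_right
  simp only [hbasis]
  constructor
  · intro h
    refine ⟨?_, fun J hJ => (h hJ).2⟩
    have := (h (mem_insert _ _)).1
    rwa [← hE, inter_eq_left.2 hI] at this
  · exact fun h J hJ => ⟨h.1.mono inter_subset_left, h.2 J hJ⟩

lemma matroid_isBase_iff_tubes (𝓕 : cs.PosFlag) (I : Set (B → ℝ)) :
    𝓕.matroid.IsBase I ↔ I ⊆ cs.posRoots ∧ LinearIndepOn ℝ id I ∧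
      ∀ C ∈ 𝓕.tubes, cs.SpansParabolic I C := by
  rw [matroid_isBase_iff]
  refine and_congr_right fun _ => and_congr_right fun _ => ?_
  constructor
  · rintro h C ⟨J, hJ, hC⟩
    exact cs.spansParabolic_iff_comps.1 (h J hJ) C hC
  · exact fun h J hJ => cs.spansParabolic_iff_comps.2 fun C hC => h C ⟨J, hJ, hC⟩

/-- A connected set that is not a component of a member of the flag fails to be spanned by some
basis of the matroid of the flag. -/
lemma exists_isBase_not_spansParabolic (𝓕 : cs.PosFlag) {t : Set B}
    (ht : (M.diagram.induce t).Connected) (htF : t ∉ 𝓕.tubes) :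
    ∃ I, 𝓕.matroid.IsBase I ∧ ¬ cs.SpansParabolic I t := by
  have hchain := 𝓕.isChain_insert_univ_sets
  obtain ⟨K, hK⟩ := (Set.toFinite {J ∈ insert univ 𝓕.sets | t ⊆ J}).exists_minimal
    ⟨univ, mem_insert _ _, subset_univ _⟩
  obtain ⟨C, hC, htC⟩ := exists_isComp_of_connected ht hK.prop.2
  -- A node of `t` outside the largest member that does not contain `t` lies only in members
  -- containing `t`.
  obtain ⟨j, hjt, hj⟩ : ∃ j ∈ t, ∀ J ∈ insert univ 𝓕.sets, j ∈ J → t ⊆ J := by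
    rcases eq_empty_or_nonempty {J ∈ insert univ 𝓕.sets | ¬ t ⊆ J} with h | h
    · obtain ⟨j, hj⟩ := nonempty_of_connected ht
      refine ⟨j, hj, fun J hJ _ => ?_⟩
      by_contra hcon
      exact (h.subset ⟨hJ, hcon⟩ : J ∈ (∅ : Set (Set B)))
    · obtain ⟨m, hm⟩ := (Set.toFinite _).exists_maximal h
      obtain ⟨j, hjt, hjm⟩ := not_subset.1 hm.prop.2
      refine ⟨j, hjt, fun J hJ hjJ => ?_⟩
      by_contra hcon
      rcases hchain.total hJ hm.prop.1 with h' | h'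
      · exact hjm (h' hjJ)
      · exact hjm (hm.le_of_ge ⟨hJ, hcon⟩ h' hjJ)
  have hCJ : ∀ J ∈ insert univ 𝓕.sets, j ∈ J → C ⊆ J := by
    intro J hJ hjJ
    refine hC.1.trans ?_
    rcases hchain.total hJ hK.prop.1 with h | h
    · exact hK.le_of_le ⟨hJ, hj J hJ hjJ⟩ h
    · exact h
  obtain ⟨β, hβ, hβC⟩ := cs.exists_posRoot_support_eq hC.2.1
  have hβj : β j ≠ 0 := by
    have : j ∈ Function.support β := by rw [hβC]; exact htC hjt
    exact this
  -- The basis consists of the simple roots with `α_j` replaced by `β`. It spans each member `J` of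
  -- the flag: if `j ∈ J`, then `C ⊆ J`, so `α_j` is recovered from `β` and the simple roots of `J`.
  set S : Set (B → ℝ) := simpleRoot '' {j}ᶜ with hS
  have hSj : ∀ x ∈ Submodule.span ℝ S, x j = 0 := by
    intro x hx
    have : Submodule.span ℝ S ≤ LinearMap.ker (LinearMap.proj j : (B → ℝ) →ₗ[ℝ] ℝ) :=
      Submodule.span_le.2 (by
        rintro _ ⟨i, hi, rfl⟩
        exact simpleRoot_of_ne (Ne.symm hi))
    exact this hx
  have hβS : β ∉ Submodule.span ℝ S := fun h => hβj (hSj β h)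
  have hSind : LinearIndepOn ℝ id S := by
    have hb : LinearIndependent ℝ (simpleRoot : B → B → ℝ) :=
      Pi.linearIndependent_single_one B ℝ
    exact hb.linearIndepOn_id.mono (image_subset_range _ _)
  refine ⟨insert β S, (𝓕.matroid_isBase_iff _).2 ⟨?_, hSind.id_insert hβS, fun J hJ => ?_⟩, ?_⟩
  · refine insert_subset hβ ?_
    rintro _ ⟨i, -, rfl⟩
    exact cs.simpleRoot_mem_posRoots i
  · have hne : ∀ i ∈ J, i ≠ j →
        simpleRoot i ∈ Submodule.span ℝ (insert β S ∩ cs.parabolicRoots J) := fun i hi hij =>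
      Submodule.subset_span ⟨.inr ⟨i, hij, rfl⟩, cs.simpleRoot_mem_parabolicRoots.2 hi⟩
    intro i hi
    by_cases hij : i = j
    · subst hij
      have hCJ' := hCJ J hJ hi
      have hβmem : β ∈ Submodule.span ℝ (insert β S ∩ cs.parabolicRoots J) :=
        Submodule.subset_span ⟨mem_insert _ _, hβ, hβC.le.trans hCJ'⟩
      have hsum : simpleRoot i = (β i)⁻¹ • (β - ∑ k ∈ Finset.univ.erase i, β k • simpleRoot k) := by
        have h1 : β = ∑ k, β k • simpleRoot k := by
          funext k
          simp [simpleRoot, Finset.sum_apply, Pi.single_apply]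
        rw [← Finset.add_sum_erase _ _ (Finset.mem_univ i)] at h1
        have h2 : β - ∑ k ∈ Finset.univ.erase i, β k • simpleRoot k = β i • simpleRoot i := by
          nth_rewrite 1 [h1]
          rw [add_sub_cancel_right]
        rw [h2, smul_smul, inv_mul_cancel₀ hβj, one_smul]
      rw [hsum]
      refine Submodule.smul_mem _ _ (Submodule.sub_mem _ hβmem (Submodule.sum_mem _ fun k hk => ?_))
      by_cases hkC : k ∈ C
      · exact Submodule.smul_mem _ _ (hne k (hCJ' hkC) (Finset.ne_of_mem_erase hk))
      · rw [Function.notMem_support.1 (show k ∉ Function.support β by rwa [hβC]), zero_smul]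
        exact Submodule.zero_mem _
    · exact hne i hi hij
  · intro h
    -- If `β` were supported in `t`, then `t = C` would be a component of `K`. Without `β`, nothing
    -- in the span involves `j`.
    have hsub : insert β S ∩ cs.parabolicRoots t ⊆ S := by
      rintro a ⟨rfl | ha, hat⟩
      · exfalso
        refine htF ⟨K, hK.prop.1, ?_⟩
        have : t = C := htC.antisymm (hβC ▸ hat.2)
        rwa [this]
      · exact ha
    have := hSj _ (Submodule.span_mono hsub (h j hjt))
    rw [simpleRoot_self] at this
    exact one_ne_zero this

/-- The matroid of a flag determines, and is determined by, the components of its members. -/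
theorem matroid_eq_iff (𝓕 𝓖 : cs.PosFlag) : 𝓕.matroid = 𝓖.matroid ↔ 𝓕.tubes = 𝓖.tubes := by
  constructor
  -- Every basis of the matroid of `𝓕` spans each tube of `𝓕`; a tube missing from `𝓖` is not
  -- spanned by some basis of the matroid of `𝓖`.
  · have key : ∀ 𝓕 𝓖 : cs.PosFlag, 𝓕.matroid = 𝓖.matroid → 𝓕.tubes ⊆ 𝓖.tubes := by
      intro 𝓕 𝓖 h t ht
      by_contra htG
      have hconn : (M.diagram.induce t).Connected := by
        obtain ⟨J, -, hJ⟩ := ht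
        exact hJ.2.1
      obtain ⟨I, hI, hspan⟩ := 𝓖.exists_isBase_not_spansParabolic hconn htG
      rw [← h, matroid_isBase_iff_tubes] at hI
      exact hspan (hI.2.2 t ht)
    exact fun h => (key 𝓕 𝓖 h).antisymm (key 𝓖 𝓕 h.symm)
  · intro h
    refine Matroid.ext_isBase ?_ fun I _ => ?_
    · rw [PosFlag.matroid, PosFlag.matroid, Bergman.flagMatroid_ground 𝓕.finite,
        Bergman.flagMatroid_ground 𝓖.finite]
    · rw [matroid_isBase_iff_tubes, matroid_isBase_iff_tubes, h]

/-- The tubing of a flag. -/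
def tubing (𝓕 : cs.PosFlag) : GTubing M.diagram :=
  ⟨𝓕.tubes \ {t | IsComp M.diagram univ t}, fun _ ⟨⟨_, _, ht⟩, ht'⟩ => ⟨ht.2.1, ht'⟩,
    fun _ ht _ hu _ => comps_compat 𝓕.isChain_insert_univ_sets ht.1 hu.1⟩

lemma tubes_eq (𝓕 : cs.PosFlag) : 𝓕.tubes = 𝓕.tubing.1 ∪ {t | IsComp M.diagram univ t} := by
  change _ = 𝓕.tubes \ _ ∪ _
  rw [sdiff_union_of_subset]
  exact fun t ht => ⟨univ, mem_insert _ _, ht⟩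

lemma tubing_eq_iff (𝓕 𝓖 : cs.PosFlag) : 𝓕.tubing = 𝓖.tubing ↔ 𝓕.matroid = 𝓖.matroid := by
  rw [matroid_eq_iff]
  refine ⟨fun h => by rw [tubes_eq, tubes_eq, h], fun h => Subtype.ext ?_⟩
  change 𝓕.tubes \ _ = 𝓖.tubes \ _
  rw [h]

/-- The refinement of chains, transported to flags. It yields both the surjectivity onto tubings and
the comparison of the orders. -/
lemma exists_superset_tubing_eq (𝓕 : cs.PosFlag) (T : GTubing M.diagram) (h : 𝓕.tubing ≤ T) :
    ∃ 𝓖 : cs.PosFlag, 𝓖.tubing = T ∧ 𝓕.carrier ⊆ 𝓖.carrier := by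
  obtain ⟨𝓓, hsub, hchain, hne, hcomps⟩ := exists_chain_comps_eq T 𝓕.sets 𝓕.isChain_sets
    𝓕.ne_of_mem_sets ((comps_mono (subset_insert _ _)).trans (by
      change 𝓕.tubes ⊆ _
      rw [tubes_eq]
      exact union_subset_union_left _ h))
  refine ⟨ofSets cs 𝓓 hchain hne, Subtype.ext ?_, ?_⟩
  · change comps M.diagram (insert univ (ofSets cs 𝓓 hchain hne).sets) \ _ = T.1
    rw [sets_ofSets, hcomps, union_sdiff_right, sdiff_eq_left]
    exact disjoint_left.2 fun t ht ht' => (T.2.1 t ht).2 ht'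
  · rw [← 𝓕.image_sets]
    exact image_mono hsub

end PosFlag

/-- The face poset of the coarse subdivision of the positive Bergman complex is the poset of
tubings of the diagram. -/
theorem nonempty_coarseCell_orderIso : Nonempty (cs.CoarseCell ≃o GTubing M.diagram) := by
  let f : cs.CoarseCell → GTubing M.diagram :=
    Quotient.lift PosFlag.tubing fun 𝓕 𝓖 h => (PosFlag.tubing_eq_iff 𝓕 𝓖).2 h
  have hf : ∀ 𝓕, f (cs.coarseCell 𝓕) = 𝓕.tubing := fun _ => rfl
  have hcell : ∀ 𝓕 𝓖 : cs.PosFlag, cs.coarseCell 𝓕 = cs.coarseCell 𝓖 ↔ 𝓕.tubing = 𝓖.tubing :=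
    fun 𝓕 𝓖 => by rw [PosFlag.tubing_eq_iff]; exact Quotient.eq
  have hinj : Function.Injective f := by
    rintro ⟨𝓕⟩ ⟨𝓖⟩ h
    exact (hcell 𝓕 𝓖).2 h
  have hsurj : Function.Surjective f := by
    intro T
    -- The empty flag has the empty tubing, so it can be refined to realize any `T`.
    let 𝓔 : cs.PosFlag := PosFlag.ofSets cs ∅ (by simp) (by simp)
    have h𝓔 : 𝓔.tubing ≤ T := by
      rintro t ⟨⟨J, hJ, ht⟩, ht'⟩
      rw [PosFlag.sets_ofSets] at hJ
      obtain rfl : J = univ := by simpa using hJ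
      exact absurd ht ht'
    obtain ⟨𝓖, h, -⟩ := 𝓔.exists_superset_tubing_eq T h𝓔
    exact ⟨cs.coarseCell 𝓖, h⟩
  refine ⟨⟨Equiv.ofBijective f ⟨hinj, hsurj⟩, ?_⟩⟩
  rintro ⟨𝓕⟩ ⟨𝓖⟩
  change 𝓕.tubing ≤ 𝓖.tubing ↔ cs.coarseCell 𝓕 ≤ cs.coarseCell 𝓖
  constructor
  -- Every flag in the cell of `𝓕` has the same tubing, so each of them refines to a flag with the
  -- tubing of `𝓖`.
  · intro h 𝓕' h𝓕'
    rw [hcell] at h𝓕'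
    obtain ⟨𝓗, h1, h2⟩ := 𝓕'.exists_superset_tubing_eq 𝓖.tubing (h𝓕' ▸ h)
    exact ⟨𝓗, (hcell _ _).2 h1, h2⟩
  · intro h
    obtain ⟨𝓗, h1, h2⟩ := h 𝓕 rfl
    rw [← (hcell _ _).1 h1]
    refine sdiff_subset_sdiff_left (comps_mono (insert_subset_insert fun J hJ => ?_))
    exact h2 hJ

end CoxeterSystem

/-! ### Assembly of the two dualities -/

theorem theorem1 {B : Type*} [Fintype B] [DecidableEq B] {M : CoxeterMatrix B}
    {W : Type*} [Group W] (cs : CoxeterSystem M W) :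
    -- connected diagrams (irreducible Coxeter systems)
    (M.diagram.Connected →
      Nonempty (cs.CoarseCell ≃o GraphAssoc.Tubing M.diagram) ∧
      (∃ P : Set (B → ℝ), GraphAssoc.IsGraphAssociahedron M.diagram P) ∧
      ∀ P : Set (B → ℝ), GraphAssoc.IsGraphAssociahedron M.diagram P →
        Nonempty (cs.CoarseCell ≃o (GraphAssoc.Face P)ᵒᵈ)) ∧
    -- arbitrary diagrams: the graph associahedron is the product over the connected components
    Nonempty (cs.CoarseCell ≃o
      ∀ C : M.diagram.ConnectedComponent, GraphAssoc.Tubing (M.diagram.induce C.supp)) ∧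
    (∃ P : ∀ C : M.diagram.ConnectedComponent, Set (C.supp → ℝ),
      ∀ C, GraphAssoc.IsGraphAssociahedron (M.diagram.induce C.supp) (P C)) ∧
    ∀ P : ∀ C : M.diagram.ConnectedComponent, Set (C.supp → ℝ),
      (∀ C, GraphAssoc.IsGraphAssociahedron (M.diagram.induce C.supp) (P C)) →
      Nonempty (cs.CoarseCell ≃o (GraphAssoc.Face (Set.univ.pi P))ᵒᵈ) := by
  obtain ⟨e⟩ := cs.nonempty_coarseCell_orderIso
  refine ⟨fun hG => ⟨⟨e.trans (GraphAssoc.gTubingEquivTubing hG)⟩,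
    GraphAssoc.exists_isGraphAssociahedron hG, fun P hP => ?_⟩,
    ⟨e.trans GraphAssoc.gTubingEquivPi⟩, ?_, fun P hP => ?_⟩
  · obtain ⟨e'⟩ := hP.nonempty_orderIso hG
    exact ⟨(e.trans (GraphAssoc.gTubingEquivTubing hG)).trans e'⟩
  · choose P hP using fun C : M.diagram.ConnectedComponent =>
      GraphAssoc.exists_isGraphAssociahedron (GraphAssoc.connected_induce_supp C)
    exact ⟨P, hP⟩
  · have e' := fun C => ((hP C).nonempty_orderIso (GraphAssoc.connected_induce_supp C)).some
    obtain ⟨e''⟩ := GraphAssoc.nonempty_orderIso_face_pi P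
    let e₁ : (∀ C : M.diagram.ConnectedComponent, GraphAssoc.Tubing (M.diagram.induce C.supp)) ≃o
        ∀ C, (GraphAssoc.Face (P C))ᵒᵈ :=
      ⟨Equiv.piCongrRight fun C => (e' C).toEquiv, forall_congr' fun C => (e' C).le_iff_le⟩
    exact ⟨((e.trans GraphAssoc.gTubingEquivPi).trans e₁).trans e''⟩
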